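/- **Model.** Let $D$, $H$, $X$ be finite sets of doctors, hospitals and contracts. Each $x\in X$ has a doctor $x_D\in D$, a hospital $x_H\in H$, a size $s(x)\ge 0$ and a utility $u(x)\ge 0$; the contracts are indexed, i.e. $X$ is linearly ordered. For $Y\subseteq X$ write $s(Y)=\sum_{x\in Y}s(x)$, $u(Y)=\sum_{x\in Y}u(x)$, $Y_h=\{x\in Y: x_H=h\}$, $Y_d=\{x\in Y: x_D=d\}$. Let $\overline s=\max_{x\in X}s(x)$ ($0$ if $X=\emptyset$). The market is *proportional* if there are constants $\beta_h>0$ ($h\in H$) with $u(x)=\beta_{x_H}\,s(x)$ for all $x\in X$. Each doctor $d$ has a strict linear preference $\succ_d$ on $X_d\cup\{\emptyset\}$, where $\emptyset$ is the null contract; $x$ is *acceptable* if $x\succ_{x_D}\emptyset$. A set $Y\subseteq X$ is a *matching* if $|Y_d|\le 1$ for all $d\in D$ and $s(Y_h)\le 1$ for all $h\in H$. For $\alpha\ge 1$, a matching $Y$ is *$\alpha$-stable* if there are no $h\in H$ and no matching $Z\subseteq X_h$ such that $u(Z)>\alpha\,u(Y_h)$ and every $x\in Z\setminus Y$ is strictly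 preferred by $x_D$ to what $x_D$ gets in $Y$ (her contract in $Y$, or $\emptyset$ if $Y_{x_D}=\emptyset$). **Mechanism.** The greedy choice $\mathrm{Ch}$ from a sequence of distinct contracts of one hospital runs through them by increasing size (ties resolved by index) and adds each contract to the chosen set as long as the total size does not exceed $1$. Generalized deferred acceptance (DA): at first nothing has been proposed and nothing is held. While there is a doctor who holds no contract and has an acceptable contract that she has not yet proposed, pick any such doctor $d$; she proposes her most preferred not yet proposed contract $x$; $x$ is appended to the sequence of contracts proposed to $h=x_H$, and $h$ from then on holds exactly $\mathrm{Ch}$ of this sequence (the contracts held by other hospitals do not change). The output is the set of contracts held at the end. **Theorem 8.** In every proportional market, whichever doctors are picked, the generalized DA mechanism with the greedy choice $\mathrm{Ch}$ is well defined, always outputs a matching, and is strategy-proof for doctors: no doctor can obtain an outcome that she strictly prefers by misreporting her preference, whatever the other doctors report. If $\overline s<1$, its output is $\frac1{1-\overline s}$-stable (with respect to the reported preferences). Moreover, the mechanism can be implemented to run in $O(|X|\log|X|)$ time on a real random access machine: there are one program and one constant $C$ such that, for every proportional market and every preference profile, with doctors, hospitals and contracts numbered and with the preferences given by a numerical rank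 of each contract and of the null contract, the program halts with an output of this mechanism, after at most $C\,|X|\log|X|$ steps if $|X|\ge 2$. (The machine has arrays of natural and of real numbers, initially zero outside the input, and unit cost for each constant, memory access, addition, subtraction, comparison and Boolean operation.) -/

import Mathlib

universe u v w

noncomputable section

/-! ### Markets, preferences, matchings -/

/-- The hospitals' side of a matching market with budget constraints: doctors `D`, hospitals `H`,
contracts `X`.  The budget of every hospital is normalised to `1`. -/
structure Market (D : Type u) (H : Type v) (X : Type w) where
  /-- the doctor of a contract -/
  doc : X → D
  /-- the hospital of a contract -/
  hosp : X → H
  /-- the size (wage) of a contract -/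
  size : X → ℝ
  /-- the (additive) utility of a contract for its hospital -/
  util : X → ℝ
  size_nonneg : ∀ x, 0 ≤ size x
  util_nonneg : ∀ x, 0 ≤ util x

namespace Market

variable {D : Type u} {H : Type v} {X : Type w}

/-- Utilities are proportional to sizes, with a positive factor for each hospital. -/
def Proportional (M : Market D H X) : Prop :=
  ∃ β : H → ℝ, (∀ h, 0 < β h) ∧ ∀ x, M.util x = β (M.hosp x) * M.size x

/-- The largest size of a contract (`0` if there is no contract). -/
def maxSize (M : Market D H X) : ℝ := ⨆ x, M.size x

/-- A strict preference of doctor `d`: a strict linear order on her contracts together with the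
null contract `none`; `rel a b` says that `a` is strictly preferred to `b`. -/
structure Pref (M : Market D H X) (d : D) where
  rel : Option {x : X // M.doc x = d} → Option {x : X // M.doc x = d} → Prop
  irrefl : ∀ a, ¬ rel a a
  trans : ∀ a b c, rel a b → rel b c → rel a c
  total : ∀ a b, a ≠ b → rel a b ∨ rel b a

/-- A profile of preferences of all the doctors. -/
abbrev Profile (M : Market D H X) : Type (max u w) := ∀ d, M.Pref d

/-- `x` is acceptable: its doctor prefers it to the null contract. -/
def Acceptable (M : Market D H X) (P : M.Profile) (x : X) : Prop :=
  (P (M.doc x)).rel (some ⟨x, rfl⟩) none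

open Classical in
/-- At most one contract per doctor, and all the budgets are respected. -/
def IsMatching (M : Market D H X) (Y : Finset X) : Prop :=
  (∀ x ∈ Y, ∀ y ∈ Y, M.doc x = M.doc y → x = y) ∧
    ∀ h, ∑ x ∈ Y with M.hosp x = h, M.size x ≤ 1

open Classical in
/-- What doctor `d` gets in the matching `Y`: her contract in `Y`, or the null contract. -/
def assigned (M : Market D H X) (Y : Finset X) (d : D) : Option {x : X // M.doc x = d} :=
  if h : ∃ x : {x : X // M.doc x = d}, x.1 ∈ Y then some h.choose else none

open Classical in
/-- `Z` is an `α`-blocking coalition of hospital `h` for `Y`: a matching of contracts of `h`, each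
of which is in `Y` or is strictly preferred by its doctor to what she gets in `Y`, with a utility
for `h` of more than `α` times the one of `Y`. -/
def IsBlocking (M : Market D H X) (P : M.Profile) (α : ℝ) (Y : Finset X) (h : H)
    (Z : Finset X) : Prop :=
  M.IsMatching Z ∧ (∀ x ∈ Z, M.hosp x = h) ∧
    (∀ x ∈ Z, x ∉ Y → (P (M.doc x)).rel (some ⟨x, rfl⟩) (M.assigned Y (M.doc x))) ∧
    α * ∑ x ∈ Y with M.hosp x = h, M.util x < ∑ x ∈ Z, M.util x

/-- `Y` is an `α`-stable matching. -/
def IsStable (M : Market D H X) (P : M.Profile) (α : ℝ) (Y : Finset X) : Prop :=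
  M.IsMatching Y ∧ ¬ ∃ (h : H) (Z : Finset X), M.IsBlocking P α Y h Z

/-- No doctor can ever gain by a misreport: `P` is the profile with the true preference of `d`,
and `P'` differs from it at most in the report of `d`. -/
def StrategyProof (M : Market D H X) (f : M.Profile → Finset X) : Prop :=
  ∀ (P P' : M.Profile) (d : D), (∀ d', d' ≠ d → P' d' = P d') →
    ¬ (P d).rel (M.assigned (f P') d) (M.assigned (f P) d)

/-! ### The generalized deferred acceptance mechanism -/

open Classical in
/-- The choice of doctor `d` from `S`: the set consisting of her most preferred contract among her
contracts in `S` if that one is acceptable, and the empty set otherwise. -/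
def docChoice (M : Market D H X) (P : M.Profile) (d : D) (S : Finset X) : Finset X :=
  {x ∈ S | M.doc x = d ∧ M.Acceptable P x ∧ ∀ (y : X) (hy : M.doc y = M.doc x), y ∈ S → y ≠ x →
    (P (M.doc x)).rel (some ⟨x, rfl⟩) (some ⟨y, hy⟩)}

/-- A state of the generalized deferred acceptance algorithm. -/
structure GDAState (H : Type v) (X : Type w) where
  /-- the contracts proposed to each hospital, in the order of the proposals -/
  prop : H → List X
  /-- the contracts that are currently held -/
  held : Finset X
  /-- all the contracts proposed so far -/
  used : Finset X

/-- The initial state. -/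
def gdaInit : GDAState H X := ⟨fun _ => [], ∅, ∅⟩

open Classical in
/-- One iteration, with the sequential choice functions `ch`: some doctor `d` who holds no contract
and who has an acceptable contract not yet proposed proposes the best such contract `x`. -/
inductive GDAStep [Fintype X] (M : Market D H X) (ch : H → List X → Finset X) (P : M.Profile) :
    GDAState H X → GDAState H X → Prop
  | propose (σ : GDAState H X) (d : D) (x : X)
      (unmatched : ∀ y ∈ σ.held, M.doc y ≠ d)
      (best : M.docChoice P d (Finset.univ \ σ.used) = {x}) :
      GDAStep M ch P σ
        { prop := Function.update σ.prop (M.hosp x) (σ.prop (M.hosp x) ++ [x])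
          held := ch (M.hosp x) (σ.prop (M.hosp x) ++ [x]) ∪
            {y ∈ σ.held | M.hosp y ≠ M.hosp x}
          used := insert x σ.used }

/-- `Y` can be the result of the generalized deferred acceptance algorithm: it is held when, after
some choices of the proposing doctors, no further iteration is possible. -/
def IsGDAOutput [Fintype X] (M : Market D H X) (ch : H → List X → Finset X) (P : M.Profile)
    (Y : Finset X) : Prop :=
  ∃ σ : GDAState H X, Relation.ReflTransGen (M.GDAStep ch P) gdaInit σ ∧
    (¬ ∃ τ, M.GDAStep ch P σ τ) ∧ σ.held = Y

/-- `f` is a generalized deferred acceptance mechanism with the choice functions `ch` (for some way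
of picking the proposing doctors, which may depend on everything). -/
def IsGDAMechanism [Fintype X] (M : Market D H X) (ch : H → List X → Finset X)
    (f : M.Profile → Finset X) : Prop :=
  ∀ P, M.IsGDAOutput ch P (f P)

/-- The order by increasing size; contracts of the same size are ordered by their index. -/
def SizeLE [LinearOrder X] (M : Market D H X) (x y : X) : Prop :=
  M.size x < M.size y ∨ (M.size x = M.size y ∧ x ≤ y)

open Classical in
/-- The increasing-size greedy choice: run through the contracts by increasing size, and take each
one that still fits into the budget. -/
def sizeGreedy [LinearOrder X] (M : Market D H X) (l : List X) : Finset X :=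
  (l.insertionSort M.SizeLE).foldl
    (fun Y x => if ∑ y ∈ Y, M.size y + M.size x ≤ 1 then insert x Y else Y) ∅

end Market

/-! ### A random access machine with exact real arithmetic

Programs with finitely many arrays of natural numbers and of real numbers, with unit cost for
every constant, memory access, addition, subtraction, comparison and Boolean operation. -/

namespace RealRAM

/-- Memory: `nat a i` is the cell `i` of the array `a` of natural numbers, `real a i` the one of
the array `a` of real numbers. -/
structure Store where
  nat : ℕ → ℕ → ℕ
  real : ℕ → ℕ → ℝ

/-- Expressions for natural numbers; subtraction is truncated. -/
inductive NExpr
  | const (k : ℕ)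
  | get (a : ℕ) (i : NExpr)
  | add (e e' : NExpr)
  | sub (e e' : NExpr)

def NExpr.eval (σ : Store) : NExpr → ℕ
  | .const k => k
  | .get a i => σ.nat a (i.eval σ)
  | .add e e' => e.eval σ + e'.eval σ
  | .sub e e' => e.eval σ - e'.eval σ

def NExpr.cost : NExpr → ℕ
  | .const _ => 1
  | .get _ i => i.cost + 1
  | .add e e' => e.cost + e'.cost + 1
  | .sub e e' => e.cost + e'.cost + 1

/-- Expressions for real numbers. -/
inductive RExpr
  | const (k : ℕ)
  | get (a : ℕ) (i : NExpr)
  | add (e e' : RExpr)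
  | sub (e e' : RExpr)

def RExpr.eval (σ : Store) : RExpr → ℝ
  | .const k => k
  | .get a i => σ.real a (i.eval σ)
  | .add e e' => e.eval σ + e'.eval σ
  | .sub e e' => e.eval σ - e'.eval σ

def RExpr.cost : RExpr → ℕ
  | .const _ => 1
  | .get _ i => i.cost + 1
  | .add e e' => e.cost + e'.cost + 1
  | .sub e e' => e.cost + e'.cost + 1

/-- Tests. -/
inductive Test
  | nle (e e' : NExpr)
  | rle (e e' : RExpr)
  | neg (b : Test)
  | conj (b b' : Test)

def Test.holds (σ : Store) : Test → Prop
  | .nle e e' => e.eval σ ≤ e'.eval σ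
  | .rle e e' => e.eval σ ≤ e'.eval σ
  | .neg b => ¬ b.holds σ
  | .conj b b' => b.holds σ ∧ b'.holds σ

def Test.cost : Test → ℕ
  | .nle e e' => e.cost + e'.cost + 1
  | .rle e e' => e.cost + e'.cost + 1
  | .neg b => b.cost + 1
  | .conj b b' => b.cost + b'.cost + 1

/-- Programs. -/
inductive Prog
  | skip
  | setNat (a : ℕ) (i e : NExpr)
  | setReal (a : ℕ) (i : NExpr) (e : RExpr)
  | seq (p q : Prog)
  | cond (b : Test) (p q : Prog)
  | loop (b : Test) (p : Prog)

/-- Assign `k` to the cell `i` of the array `a`. -/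
def Store.writeNat (σ : Store) (a i k : ℕ) : Store :=
  { σ with nat := Function.update σ.nat a (Function.update (σ.nat a) i k) }

def Store.writeReal (σ : Store) (a i : ℕ) (r : ℝ) : Store :=
  { σ with real := Function.update σ.real a (Function.update (σ.real a) i r) }

/-- `Exec p σ τ t`: started on `σ`, the program `p` halts on `τ` after `t` steps.  At most one rule
applies to each `p` and `σ`, so that `τ` and `t` are unique if they exist. -/
inductive Exec : Prog → Store → Store → ℕ → Prop
  | skip (σ : Store) : Exec .skip σ σ 1
  | setNat (σ : Store) (a : ℕ) (i e : NExpr) :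
      Exec (.setNat a i e) σ (σ.writeNat a (i.eval σ) (e.eval σ)) (i.cost + e.cost + 1)
  | setReal (σ : Store) (a : ℕ) (i : NExpr) (e : RExpr) :
      Exec (.setReal a i e) σ (σ.writeReal a (i.eval σ) (e.eval σ)) (i.cost + e.cost + 1)
  | seq {p q : Prog} {σ τ υ : Store} {t t' : ℕ} :
      Exec p σ τ t → Exec q τ υ t' → Exec (.seq p q) σ υ (t + t')
  | condTrue {b : Test} {p q : Prog} {σ τ : Store} {t : ℕ} :
      b.holds σ → Exec p σ τ t → Exec (.cond b p q) σ τ (b.cost + t)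
  | condFalse {b : Test} {p q : Prog} {σ τ : Store} {t : ℕ} :
      ¬ b.holds σ → Exec q σ τ t → Exec (.cond b p q) σ τ (b.cost + t)
  | loopTrue {b : Test} {p : Prog} {σ τ υ : Store} {t t' : ℕ} :
      b.holds σ → Exec p σ τ t → Exec (.loop b p) τ υ t' → Exec (.loop b p) σ υ (b.cost + t + t')
  | loopFalse {b : Test} {p : Prog} {σ : Store} :
      ¬ b.holds σ → Exec (.loop b p) σ σ b.cost

end RealRAM

/-! ### Input and output of a machine that runs a mechanism -/

namespace Market

variable {nD nH n : ℕ}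

/-- `rank` represents the preferences by numbers; a smaller number is better. -/
def Ranks (M : Market (Fin nD) (Fin nH) (Fin n)) (P : M.Profile)
    (rank : ∀ d, Option {x : Fin n // M.doc x = d} → ℕ) : Prop :=
  ∀ d a b, (P d).rel a b ↔ rank d a < rank d b

/-- The input, for numbered doctors, hospitals and contracts.  Natural numbers: array `0` holds the
number of contracts, `1` the doctor of each contract, `2` its hospital, `3` its rank for its
doctor, and `4` the rank of the null contract for each doctor.  Real numbers: array `0` holds the
sizes of the contracts.  All the other cells are `0`. -/
def inputStore (M : Market (Fin nD) (Fin nH) (Fin n))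
    (rank : ∀ d, Option {x : Fin n // M.doc x = d} → ℕ) : RealRAM.Store where
  nat a i := match a with
    | 0 => if i = 0 then n else 0
    | 1 => if h : i < n then (M.doc ⟨i, h⟩ : ℕ) else 0
    | 2 => if h : i < n then (M.hosp ⟨i, h⟩ : ℕ) else 0
    | 3 => if h : i < n then rank (M.doc ⟨i, h⟩) (some ⟨⟨i, h⟩, rfl⟩) else 0
    | 4 => if h : i < nD then rank ⟨i, h⟩ none else 0
    | _ => 0
  real a i := match a with
    | 0 => if h : i < n then M.size ⟨i, h⟩ else 0
    | _ => 0

/-- The output: the contracts that are marked by a nonzero number in array `5`. -/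
def outputSet (n : ℕ) (σ : RealRAM.Store) : Finset (Fin n) :=
  {x | σ.nat 5 x ≠ 0}

end Market

end

/-!
The argument rests on a description of the greedy choice. Since the contracts are tried by
increasing size, a contract that does not fit is followed only by larger ones, which do not fit
either; so the greedy choice from a set consists of the contracts that fit together with *all* the
smaller contracts of their hospital (`Market.choose`, `Market.sizeGreedy_eq_choose`). Hence a
contract that is rejected from a set is rejected from any larger set (`mem_choose_of_subset`), and
when a contract is added, either nothing changes, or it is added to the choice, or it is added and
the largest chosen contract is dropped (`choose_insert_of_lt`, `choose_insert_of_le`,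
`choose_insert_of_exceeds`). In particular the number of chosen contracts never goes down
(`card_choose_mono`).

All reachable states satisfy `GDAInvariant`; it implies that outputs are matchings. *Stability*: a
contract of a blocking coalition that is not held has been rejected, so that its hospital has spent
more than `1 - maxSize`, while the coalition can spend at most `1`; with proportional utilities this
bounds the gain (`GDAInvariant.isStable`). *Strategy-proofness*: suppose that a misreport leads a
doctor to `x`, and that the truth leads her to something worse. If she accepts only `x`, she gets
`x`; if she accepts exactly `x` and what is better than `x`, she gets nothing. Both follow from
`exists_held_of_run`, which rests on the fact that nothing outside of a stable set of proposals is
ever proposed (`used_subset_of_stable`). But accepting fewer contracts cannot help an unmatched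
doctor, by counting the matched doctors (`unmatched_of_unmatched`).

*Running time.* The machine has neither division nor procedures, so that sorting is done with a
tournament tree in which the parents of the nodes are tabulated; the winners are pushed on linked
lists (`RealRAM.exec_lists`). This yields the list of the acceptable contracts of each doctor, the
best one first, and the list of the contracts of each hospital, the largest one first. By the
description of the choice above, a hospital that exceeds its budget drops its largest contract and
never needs a contract again that is at least as large. So it suffices to move along its list, and
deferred acceptance takes linear time: each iteration makes a proposal or considers the next
contract as a starting point, and list entries of the hospitals are passed only once
(`Market.potential`, `Market.proposeBody_spec`).
-/

noncomputable section

/-! ### The greedy choice -/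

namespace Market

variable {D : Type u} {H : Type v} {X : Type w}

section Choice

variable [LinearOrder X] (M : Market D H X)

theorem sizeLE_iff_toLex {x y : X} :
    M.SizeLE x y ↔ toLex (M.size x, x) ≤ toLex (M.size y, y) := by
  simp [SizeLE, Prod.Lex.le_iff]

theorem SizeLE.refl (x : X) : M.SizeLE x x := Or.inr ⟨rfl, le_rfl⟩

variable {M}

theorem SizeLE.trans {x y z : X} (h : M.SizeLE x y) (h' : M.SizeLE y z) : M.SizeLE x z := by
  rw [sizeLE_iff_toLex] at *
  exact h.trans h'

theorem SizeLE.antisymm {x y : X} (h : M.SizeLE x y) (h' : M.SizeLE y x) : x = y := by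
  rw [sizeLE_iff_toLex] at *
  have := h.antisymm h'
  simp at this
  exact this.2

theorem SizeLE.total (x y : X) : M.SizeLE x y ∨ M.SizeLE y x := by
  simp only [sizeLE_iff_toLex]
  exact le_total _ _

theorem SizeLE.size_le {x y : X} (h : M.SizeLE x y) : M.size x ≤ M.size y := by
  rcases h with h | h
  · exact h.le
  · exact h.1.le

theorem exists_largest {S : Finset X} (hS : S.Nonempty) : ∃ m ∈ S, ∀ x ∈ S, M.SizeLE x m := by
  obtain ⟨m, hm, h⟩ := S.exists_max_image (fun x => toLex (M.size x, x)) hS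
  exact ⟨m, hm, fun x hx => M.sizeLE_iff_toLex.2 (h x hx)⟩

theorem exists_smallest {S : Finset X} (hS : S.Nonempty) : ∃ m ∈ S, ∀ x ∈ S, M.SizeLE m x := by
  obtain ⟨m, hm, h⟩ := S.exists_min_image (fun x => toLex (M.size x, x)) hS
  exact ⟨m, hm, fun x hx => M.sizeLE_iff_toLex.2 (h x hx)⟩

variable (M)

open Classical in
/-- The total size of the contracts of `S` that compete with `x` for the budget of its hospital
and are not larger than `x`, with ties resolved by index (`x` itself counts if it is in `S`). -/
def load (S : Finset X) (x : X) : ℝ :=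
  ∑ y ∈ S with M.hosp y = M.hosp x ∧ M.SizeLE y x, M.size y

open Classical in
/-- The total size of the contracts of the hospital `h` in `S`. -/
def totalSize (S : Finset X) (h : H) : ℝ := ∑ y ∈ S with M.hosp y = h, M.size y

open Classical in
/-- The greedy choices of all the hospitals from `S` at once: since a contract that does not fit is
followed only by larger ones, a contract is chosen if and only if it fits together with *all*
the smaller contracts of its hospital. -/
def choose (S : Finset X) : Finset X := {x ∈ S | M.load S x ≤ 1}

variable {M}

theorem mem_choose {S : Finset X} {x : X} : x ∈ M.choose S ↔ x ∈ S ∧ M.load S x ≤ 1 := by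
  simp [choose]

theorem choose_subset (S : Finset X) : M.choose S ⊆ S := fun _ hx => (mem_choose.1 hx).1

theorem load_le_load_of_subset {S T : Finset X} (h : S ⊆ T) (x : X) :
    M.load S x ≤ M.load T x := by
  classical
  exact Finset.sum_le_sum_of_subset_of_nonneg (Finset.filter_subset_filter _ h)
    fun _ _ _ => M.size_nonneg _

theorem load_le_load_of_sizeLE {S : Finset X} {x y : X} (hh : M.hosp x = M.hosp y)
    (h : M.SizeLE x y) : M.load S x ≤ M.load S y := by
  refine Finset.sum_le_sum_of_subset_of_nonneg (fun z hz => ?_) fun _ _ _ => M.size_nonneg _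
  simp only [Finset.mem_filter] at hz ⊢
  exact ⟨hz.1, hz.2.1.trans hh, hz.2.2.trans h⟩

/-- Substitutability: what is chosen from a set is also chosen from any smaller set. -/
theorem mem_choose_of_subset {S T : Finset X} (h : S ⊆ T) {x : X} (hx : x ∈ S)
    (hT : x ∈ M.choose T) : x ∈ M.choose S :=
  mem_choose.2 ⟨hx, (load_le_load_of_subset h x).trans (mem_choose.1 hT).2⟩

theorem mem_choose_of_sizeLE {S : Finset X} {x y : X} (hx : x ∈ S) (hy : y ∈ M.choose S)
    (hh : M.hosp x = M.hosp y) (h : M.SizeLE x y) : x ∈ M.choose S :=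
  mem_choose.2 ⟨hx, (load_le_load_of_sizeLE hh h).trans (mem_choose.1 hy).2⟩

theorem load_insert {S : Finset X} {x : X} (hx : x ∉ S) (z : X) [Decidable (M.SizeLE x z)]
    [Decidable (M.hosp x = M.hosp z)] :
    M.load (insert x S) z =
      M.load S z + if M.hosp x = M.hosp z ∧ M.SizeLE x z then M.size x else 0 := by
  classical
  unfold load
  rw [Finset.filter_insert]
  split_ifs with h
  · rw [Finset.sum_insert (by simp [hx]), add_comm]
  · simp

theorem load_add_size_le {S : Finset X} {y z : X} (hy : y ∈ S) (hh : M.hosp z = M.hosp y)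
    (hle : M.SizeLE z y) (hne : z ≠ y ∨ z ∉ S) : M.load S z + M.size y ≤ M.load S y := by
  classical
  rcases eq_or_ne z y with rfl | hzy
  · simp_all
  unfold load
  rw [add_comm, ← Finset.sum_insert (s := {w ∈ S | M.hosp w = M.hosp z ∧ M.SizeLE w z})
    (by simp only [Finset.mem_filter, not_and]; exact fun _ _ h => hzy (hle.antisymm h))]
  refine Finset.sum_le_sum_of_subset_of_nonneg (fun w hw => ?_) fun _ _ _ => M.size_nonneg _
  simp only [Finset.mem_insert, Finset.mem_filter] at hw ⊢
  rcases hw with rfl | hw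
  · exact ⟨hy, rfl, SizeLE.refl M _⟩
  · exact ⟨hw.1, hw.2.1.trans hh, hw.2.2.trans hle⟩

theorem totalSize_le_load {S T : Finset X} {x : X} (hST : S ⊆ T)
    (h : ∀ y ∈ S, M.hosp y = M.hosp x → M.SizeLE y x) : M.totalSize S (M.hosp x) ≤ M.load T x := by
  refine Finset.sum_le_sum_of_subset_of_nonneg (fun z hz => ?_) fun _ _ _ => M.size_nonneg _
  simp only [Finset.mem_filter] at hz ⊢
  exact ⟨hST hz.1, hz.2, h z hz.1 hz.2⟩

theorem totalSize_insert {S : Finset X} {x : X} (hx : x ∉ S) (h : H)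
    [Decidable (M.hosp x = h)] :
    M.totalSize (insert x S) h = M.totalSize S h + if M.hosp x = h then M.size x else 0 := by
  classical
  unfold totalSize
  rw [Finset.filter_insert]
  split_ifs with h
  · rw [Finset.sum_insert (by simp [hx]), add_comm]
  · simp

theorem totalSize_erase {S : Finset X} {x : X} (hx : x ∈ S) (h : H)
    [Decidable (M.hosp x = h)] :
    M.totalSize (S.erase x) h = M.totalSize S h - if M.hosp x = h then M.size x else 0 := by
  conv_rhs => rw [← Finset.insert_erase hx, totalSize_insert (Finset.notMem_erase x S)]
  ring

theorem totalSize_choose_le_one (S : Finset X) (h : H) : M.totalSize (M.choose S) h ≤ 1 := by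
  classical
  rcases ({y ∈ M.choose S | M.hosp y = h} : Finset X).eq_empty_or_nonempty with h0 | h0
  · simp [totalSize, h0]
  · obtain ⟨m, hm, hmax⟩ := exists_largest (M := M) h0
    simp only [Finset.mem_filter] at hm hmax
    obtain ⟨hm, rfl⟩ := hm
    exact (totalSize_le_load (choose_subset S) fun y hy hyh => hmax y ⟨hy, hyh⟩).trans
      (mem_choose.1 hm).2

/-- A rejected contract does not fit together with the chosen ones, even if it is smaller. -/
theorem one_lt_totalSize_add_of_notMem {S : Finset X} {r : X} (hr : r ∈ S)
    (hr' : r ∉ M.choose S) : 1 < M.totalSize (M.choose S) (M.hosp r) + M.size r := by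
  classical
  obtain ⟨m, hm, hmin⟩ := exists_smallest (M := M)
    (S := {y ∈ S | M.hosp y = M.hosp r ∧ y ∉ M.choose S}) ⟨r, by simp [hr, hr']⟩
  simp only [Finset.mem_filter, and_imp] at hm hmin
  have h1 : 1 < M.load S m := by
    by_contra h
    exact hm.2.2 (mem_choose.2 ⟨hm.1, not_lt.1 h⟩)
  have h2 : M.size m ≤ M.size r := (hmin r hr rfl hr').size_le
  have h3 : M.load S m ≤ M.totalSize (insert m (M.choose S)) (M.hosp r) := by
    refine Finset.sum_le_sum_of_subset_of_nonneg (fun z hz => ?_) fun _ _ _ => M.size_nonneg _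
    simp only [Finset.mem_filter, Finset.mem_insert] at hz ⊢
    refine ⟨?_, hz.2.1.trans hm.2.1⟩
    by_contra! h
    exact h.1 (hz.2.2.antisymm (hmin z hz.1 (hz.2.1.trans hm.2.1) h.2))
  rw [totalSize_insert hm.2.2, if_pos hm.2.1] at h3
  linarith

theorem choose_insert_of_lt {S : Finset X} {x : X} (hx : x ∉ S)
    (h : 1 < M.load (insert x S) x) : M.choose (insert x S) = M.choose S := by
  classical
  ext z
  rcases eq_or_ne z x with rfl | hzx
  · simp [mem_choose, hx, h]
  · simp only [mem_choose, Finset.mem_insert, hzx, false_or]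
    refine and_congr_right fun hz => ?_
    by_cases hc : M.hosp x = M.hosp z ∧ M.SizeLE x z
    · have h1 := load_add_size_le (M := M) hz hc.1 hc.2 (.inl hzx.symm)
      have h2 := hc.2.size_le
      have h3 := load_le_load_of_subset (M := M) (Finset.subset_insert x S) z
      rw [load_insert hx, if_pos ⟨rfl, SizeLE.refl M _⟩] at h
      constructor <;> intro <;> linarith
    · rw [load_insert hx, if_neg hc, add_zero]

theorem choose_insert_of_le {S : Finset X} {x : X} (hx : x ∉ S)
    (h : M.totalSize (M.choose S) (M.hosp x) + M.size x ≤ 1) :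
    M.choose (insert x S) = insert x (M.choose S) := by
  classical
  have hlt : ∀ r ∈ S, M.hosp r = M.hosp x → r ∉ M.choose S → M.size x < M.size r := by
    intro r hr hrx hr'
    have := one_lt_totalSize_add_of_notMem hr hr'
    rw [hrx] at this
    linarith
  -- the contracts below `x` or below a chosen one are chosen or equal to `x`
  have hload : ∀ z ∈ insert x (M.choose S), M.hosp z = M.hosp x →
      M.load (insert x S) z ≤ M.totalSize (insert x (M.choose S)) (M.hosp x) := by
    intro z hz hzx
    refine Finset.sum_le_sum_of_subset_of_nonneg (fun r hr => ?_) fun _ _ _ => M.size_nonneg _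
    simp only [Finset.mem_filter, Finset.mem_insert] at hz hr ⊢
    obtain ⟨hr | hr, hrz, hle⟩ := hr
    · exact ⟨.inl hr, hrz.trans hzx⟩
    · refine ⟨.inr ?_, hrz.trans hzx⟩
      rcases hz with rfl | hz
      · by_contra hr'
        exact absurd hle.size_le (not_le.2 (hlt r hr hrz hr'))
      · exact mem_choose_of_sizeLE hr hz hrz hle
  rw [totalSize_insert (fun h => hx (choose_subset S h)), if_pos rfl] at hload
  ext z
  constructor
  · intro hz
    rcases Finset.mem_insert.1 (choose_subset _ hz) with rfl | hzS
    · exact Finset.mem_insert_self _ _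
    · exact Finset.mem_insert_of_mem (mem_choose_of_subset (Finset.subset_insert x S) hzS hz)
  · intro hz
    refine mem_choose.2 ⟨Finset.insert_subset_insert x (choose_subset S) hz, ?_⟩
    by_cases hzx : M.hosp z = M.hosp x
    · exact (hload z hz hzx).trans h
    · rw [load_insert hx, if_neg (fun h => hzx h.1.symm), add_zero]
      rcases Finset.mem_insert.1 hz with rfl | hz
      · exact absurd rfl hzx
      · exact (mem_choose.1 hz).2

/-- If a new contract does not fit, at most one contract has to go: the largest one. -/
theorem choose_insert_of_exceeds {S : Finset X} {x y : X} (hx : x ∉ S)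
    (h : 1 < M.totalSize (M.choose S) (M.hosp x) + M.size x) (hy : y ∈ insert x (M.choose S))
    (hyx : M.hosp y = M.hosp x)
    (hmax : ∀ z ∈ insert x (M.choose S), M.hosp z = M.hosp x → M.SizeLE z y) :
    M.choose (insert x S) = (insert x (M.choose S)).erase y := by
  classical
  have hxC : x ∉ M.choose S := fun h => hx (choose_subset S h)
  have hyload : 1 < M.load (insert x S) y := by
    refine h.trans_le ?_
    have := totalSize_le_load (M := M) (T := insert x S) (x := y)
      (Finset.insert_subset_insert x (choose_subset S)) (fun z hz hzy => hmax z hz (hzy.trans hyx))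
    rwa [hyx, totalSize_insert hxC, if_pos rfl] at this
  ext z
  constructor
  · intro hz
    refine Finset.mem_erase.2 ⟨?_, ?_⟩
    · rintro rfl
      exact absurd (mem_choose.1 hz).2 (not_le.2 hyload)
    rcases Finset.mem_insert.1 (choose_subset _ hz) with rfl | hzS
    · exact Finset.mem_insert_self _ _
    · exact Finset.mem_insert_of_mem (mem_choose_of_subset (Finset.subset_insert x S) hzS hz)
  · intro hz
    obtain ⟨hzy, hz⟩ := Finset.mem_erase.1 hz
    refine mem_choose.2 ⟨Finset.insert_subset_insert x (choose_subset S) hz, ?_⟩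
    rw [load_insert hx]
    split_ifs with hc
    · have hle := hmax z hz hc.1.symm
      have hyC : y ∈ M.choose S := by
        rcases Finset.mem_insert.1 hy with rfl | hy
        · exact absurd (hle.antisymm hc.2) hzy
        · exact hy
      have h1 := load_add_size_le (choose_subset S hyC) (hc.1.symm.trans hyx.symm) hle (.inl hzy)
      have h2 := (hc.2.trans hle).size_le
      linarith [(mem_choose.1 hyC).2]
    · rcases Finset.mem_insert.1 hz with rfl | hz
      · exact absurd ⟨rfl, SizeLE.refl M _⟩ hc
      · rw [add_zero]
        exact (mem_choose.1 hz).2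

theorem card_choose_le_card_choose_insert (S : Finset X) (x : X) :
    (M.choose S).card ≤ (M.choose (insert x S)).card := by
  classical
  by_cases hx : x ∈ S
  · rw [Finset.insert_eq_of_mem hx]
  have hxC : x ∉ M.choose S := fun h => hx (choose_subset S h)
  by_cases h : M.totalSize (M.choose S) (M.hosp x) + M.size x ≤ 1
  · rw [choose_insert_of_le hx h]
    exact Finset.card_le_card (Finset.subset_insert _ _)
  · obtain ⟨y, hy, hmax⟩ := exists_largest (M := M)
      (S := {z ∈ insert x (M.choose S) | M.hosp z = M.hosp x}) ⟨x, by simp⟩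
    simp only [Finset.mem_filter] at hy hmax
    rw [choose_insert_of_exceeds hx (not_le.1 h) hy.1 hy.2 fun z hz hzx => hmax z ⟨hz, hzx⟩,
      Finset.card_erase_of_mem hy.1, Finset.card_insert_of_notMem hxC]
    simp

/-- The law of aggregate demand: more offers never lead to fewer chosen contracts. -/
theorem card_choose_mono {S T : Finset X} (h : S ⊆ T) :
    (M.choose S).card ≤ (M.choose T).card := by
  classical
  have key : ∀ U : Finset X, (M.choose S).card ≤ (M.choose (S ∪ U)).card := by
    intro U
    induction U using Finset.induction_on with
    | empty => simp
    | insert z U _ ih =>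
      rw [Finset.union_insert]
      exact ih.trans (card_choose_le_card_choose_insert _ _)
  simpa [Finset.union_eq_right.2 h] using key T

end Choice

end Market

/-! ### Deferred acceptance: invariant, stability and strategy-proofness -/

namespace Market

variable {D : Type u} {H : Type v} {X : Type w}

section Greedy

variable [LinearOrder X] {M : Market D H X}

theorem choose_empty : M.choose ∅ = ∅ := Finset.subset_empty.1 (choose_subset ∅)

open Classical in
theorem foldl_greedy_eq_choose {h : H} (l : List X) (hs : l.Pairwise M.SizeLE) (hn : l.Nodup)
    (hh : ∀ x ∈ l, M.hosp x = h) :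
    l.foldl (fun Y x => if ∑ y ∈ Y, M.size y + M.size x ≤ 1 then insert x Y else Y) ∅ =
      M.choose l.toFinset := by
  induction l using List.reverseRecOn with
  | nil => exact choose_empty.symm
  | append_singleton l x ih =>
    rw [List.pairwise_append] at hs
    simp only [List.nodup_append, List.mem_singleton, forall_eq] at hn
    simp only [List.mem_append, List.mem_singleton] at hh
    have hxl : x ∉ l.toFinset := fun h => hn.2.2 x (List.mem_toFinset.1 h) rfl
    have hx : M.hosp x = h := hh x (.inr rfl)
    have hsum : ∑ y ∈ M.choose l.toFinset, M.size y
        = M.totalSize (M.choose l.toFinset) (M.hosp x) := by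
      unfold totalSize
      rw [Finset.filter_true_of_mem]
      intro y hy
      rw [hx]
      exact hh y (.inl (List.mem_toFinset.1 (choose_subset _ hy)))
    have hins : (l ++ [x]).toFinset = insert x l.toFinset := by
      ext; simp
    rw [List.foldl_append, ih hs.1 hn.1 fun y hy => hh y (.inl hy), hins, List.foldl_cons,
      List.foldl_nil, hsum]
    split_ifs with hle
    · rw [choose_insert_of_le hxl hle]
    · rw [choose_insert_of_lt hxl]
      have := totalSize_le_load (M := M) (x := x)
        (Finset.insert_subset_insert x (choose_subset (M := M) l.toFinset)) fun y hy _ => by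
          rcases Finset.mem_insert.1 hy with rfl | hy
          · exact SizeLE.refl M _
          · exact hs.2.2 y (List.mem_toFinset.1 (choose_subset _ hy)) x (by simp)
      rw [totalSize_insert (fun h => hxl (choose_subset _ h)), if_pos rfl] at this
      exact (not_le.1 hle).trans_le this

theorem sizeGreedy_eq_choose {h : H} (l : List X) (hn : l.Nodup)
    (hh : ∀ x ∈ l, M.hosp x = h) : M.sizeGreedy l = M.choose l.toFinset := by
  classical
  have : Std.Total M.SizeLE := ⟨SizeLE.total⟩
  have : IsTrans X M.SizeLE := ⟨fun _ _ _ => SizeLE.trans⟩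
  have hp := List.perm_insertionSort M.SizeLE l
  have := foldl_greedy_eq_choose (M := M) (h := h) (l.insertionSort M.SizeLE)
    (List.pairwise_insertionSort _ l) (hp.nodup_iff.2 hn) fun x hx => hh x (hp.mem_iff.1 hx)
  rw [List.toFinset_eq_of_perm _ _ hp] at this
  unfold sizeGreedy
  convert this

end Greedy

section Preferences

variable {M : Market D H X} {P : M.Profile}

/-- `x` and `y` have the same doctor, who strictly prefers `x` to `y`. -/
def Prefers (M : Market D H X) (P : M.Profile) (x y : X) : Prop :=
  ∃ hy : M.doc y = M.doc x, (P (M.doc x)).rel (some ⟨x, rfl⟩) (some ⟨y, hy⟩)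

theorem rel_some_iff {d : D} {x y : X} (hx : M.doc x = d) (hy : M.doc y = d) :
    (P d).rel (some ⟨x, hx⟩) (some ⟨y, hy⟩) ↔ M.Prefers P x y := by
  subst hx
  exact ⟨fun h => ⟨hy, h⟩, fun h => h.2⟩

theorem rel_some_none_iff {d : D} {x : X} (hx : M.doc x = d) :
    (P d).rel (some ⟨x, hx⟩) none ↔ M.Acceptable P x := by
  subst hx
  rfl

theorem Prefers.doc_eq {x y : X} (h : M.Prefers P x y) : M.doc x = M.doc y := h.1.symm

theorem Prefers.irrefl (x : X) : ¬ M.Prefers P x x := fun h => (P _).irrefl _ h.2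

theorem Prefers.trans {x y z : X} (h : M.Prefers P x y) (h' : M.Prefers P y z) :
    M.Prefers P x z := by
  have h1 := (rel_some_iff rfl h.doc_eq.symm).2 h
  have h2 := (rel_some_iff h.doc_eq.symm (h.doc_eq.trans h'.doc_eq).symm).2 h'
  exact (rel_some_iff _ _).1 ((P _).trans _ _ _ h1 h2)

theorem Prefers.total {x y : X} (h : M.doc x = M.doc y) (hne : x ≠ y) :
    M.Prefers P x y ∨ M.Prefers P y x := by
  rw [← rel_some_iff h rfl, ← rel_some_iff rfl h]
  exact (P _).total _ _ (by simpa using hne)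

theorem Prefers.acceptable {x y : X} (h : M.Prefers P x y) (hy : M.Acceptable P y) :
    M.Acceptable P x :=
  (P _).trans _ _ _ h.2 ((rel_some_none_iff _).2 hy)

theorem docChoice_eq_singleton_iff {d : D} {S : Finset X} {x : X} :
    M.docChoice P d S = {x} ↔ x ∈ S ∧ M.doc x = d ∧ M.Acceptable P x ∧
      ∀ y ∈ S, M.doc y = d → y ≠ x → M.Prefers P x y := by
  classical
  constructor
  · intro h
    have hx : x ∈ M.docChoice P d S := by simp [h]
    simp only [docChoice, Finset.mem_filter] at hx
    obtain ⟨h1, rfl, h3, h4⟩ := hx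
    exact ⟨h1, rfl, h3, fun y hy hd hne => ⟨hd, h4 y hd hy hne⟩⟩
  · rintro ⟨h1, rfl, h3, h4⟩
    ext y
    simp only [docChoice, Finset.mem_filter, Finset.mem_singleton]
    constructor
    · rintro ⟨hy, hd, -, hbest⟩
      by_contra hne
      have h5 : M.Prefers P y x := ⟨hd.symm, hbest x hd.symm h1 (Ne.symm hne)⟩
      exact Prefers.irrefl _ (h5.trans (h4 y hy hd hne))
    · rintro rfl
      exact ⟨h1, rfl, h3, fun z hz hzS hne => (h4 z hzS hz hne).2⟩

theorem exists_docChoice_eq_singleton [Finite X] {d : D} {S : Finset X} {x : X} (hx : x ∈ S)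
    (hd : M.doc x = d) (ha : M.Acceptable P x) : ∃ y, M.docChoice P d S = {y} := by
  have : IsTrans X (M.Prefers P) := ⟨fun _ _ _ => Prefers.trans⟩
  have : Std.Irrefl (M.Prefers P) := ⟨Prefers.irrefl⟩
  have hwf : WellFounded (M.Prefers P) := Finite.wellFounded_of_trans_of_irrefl _
  obtain ⟨m, ⟨hm, hmd⟩, hmin⟩ := hwf.has_min {y | y ∈ S ∧ M.doc y = d} ⟨x, hx, hd⟩
  have hbest : ∀ y ∈ S, M.doc y = d → y ≠ m → M.Prefers P m y := fun y hy hyd hne =>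
    (Prefers.total (hyd.trans hmd.symm) hne).resolve_left (hmin y ⟨hy, hyd⟩)
  refine ⟨m, docChoice_eq_singleton_iff.2 ⟨hm, hmd, ?_, hbest⟩⟩
  rcases eq_or_ne x m with rfl | hne
  · exact ha
  · exact (hbest x hx hd hne).acceptable ha

theorem assigned_eq_none {Y : Finset X} {d : D} (h : ∀ y ∈ Y, M.doc y ≠ d) :
    M.assigned Y d = none := by
  unfold assigned
  rw [dif_neg]
  rintro ⟨⟨x, hx⟩, hxY⟩
  exact h x hxY hx

theorem assigned_eq_some {Y : Finset X} {d : D} {x : X} (hd : M.doc x = d) (hx : x ∈ Y)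
    (huniq : ∀ y ∈ Y, M.doc y = d → y = x) : M.assigned Y d = some ⟨x, hd⟩ := by
  have h : ∃ x : {x : X // M.doc x = d}, x.1 ∈ Y := ⟨⟨x, hd⟩, hx⟩
  unfold assigned
  rw [dif_pos h]
  congr 1
  exact Subtype.ext (huniq _ h.choose_spec h.choose.2)

open Classical in
/-- The position of a contract or of the null contract after making exactly the contracts in `S`
acceptable. -/
def keepLevel {M : Market D H X} {d : D} (S : Set X) :
    Option {x : X // M.doc x = d} → ℕ
  | none => 1
  | some x => if x.1 ∈ S then 0 else 2

/-- The preference obtained from `p` by making exactly the contracts in `S` acceptable, and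
keeping the order of the contracts within `S` and within the complement of `S`. -/
def Pref.keep {M : Market D H X} {d : D} (p : M.Pref d) (S : Set X) : M.Pref d where
  rel a b := keepLevel S a < keepLevel S b ∨ keepLevel S a = keepLevel S b ∧ p.rel a b
  irrefl a h := by
    rcases h with h | h
    · exact lt_irrefl _ h
    · exact p.irrefl a h.2
  trans a b c h h' := by
    rcases h with h | h <;> rcases h' with h' | h'
    · exact .inl (h.trans h')
    · exact .inl (h'.1 ▸ h)
    · exact .inl (h.1 ▸ h')
    · exact .inr ⟨h.1.trans h'.1, p.trans _ _ _ h.2 h'.2⟩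
  total a b hab := by
    rcases lt_trichotomy (keepLevel S a) (keepLevel S b) with h | h | h
    · exact .inl (.inl h)
    · exact (p.total a b hab).imp (fun h' => .inr ⟨h, h'⟩) fun h' => .inr ⟨h.symm, h'⟩
    · exact .inr (.inl h)

open Classical in
/-- The profile in which `d` finds exactly the contracts in `S` acceptable. -/
def keepOnly (P : M.Profile) (d : D) (S : Set X) : M.Profile :=
  Function.update P d ((P d).keep S)

theorem acceptable_keepOnly {P : M.Profile} {d : D} {S : Set X} {x : X} (hx : M.doc x = d) :
    M.Acceptable (M.keepOnly P d S) x ↔ x ∈ S := by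
  classical
  subst hx
  simp only [Acceptable, keepOnly, Function.update_self, Pref.keep, keepLevel]
  split_ifs with h <;> simp [h]

theorem prefers_keepOnly {P : M.Profile} {d : D} {S : Set X} {x y : X} (hd : M.doc x = d)
    (hx : x ∈ S) (hy : y ∈ S) : M.Prefers (M.keepOnly P d S) x y ↔ M.Prefers P x y := by
  classical
  subst hd
  simp [Prefers, keepOnly, Pref.keep, keepLevel, hx, hy]

theorem acceptable_congr {P P' : M.Profile} {x : X} (h : P (M.doc x) = P' (M.doc x)) :
    M.Acceptable P x ↔ M.Acceptable P' x := by
  unfold Acceptable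
  rw [h]

theorem prefers_congr {P P' : M.Profile} {x y : X} (h : P (M.doc x) = P' (M.doc x)) :
    M.Prefers P x y ↔ M.Prefers P' x y := by
  unfold Prefers
  rw [h]

theorem keepOnly_of_ne {P : M.Profile} {d d' : D} {S : Set X} (h : d' ≠ d) :
    M.keepOnly P d S d' = P d' := by
  classical
  exact Function.update_of_ne h _ _

end Preferences

section Invariant

variable [LinearOrder X] {M : Market D H X} {P : M.Profile}

/-- What holds in all reachable states: the hospitals hold their greedy choices from all the
proposed contracts, and every doctor has proposed an initial segment of her acceptable contracts,
of which she can hold only the last one. -/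
structure GDAInvariant (M : Market D H X) (P : M.Profile) (σ : GDAState H X) : Prop where
  held_eq : σ.held = M.choose σ.used
  mem_prop : ∀ h x, x ∈ σ.prop h ↔ x ∈ σ.used ∧ M.hosp x = h
  nodup_prop : ∀ h, (σ.prop h).Nodup
  acceptable : ∀ x ∈ σ.used, M.Acceptable P x
  closed : ∀ x ∈ σ.used, ∀ y, M.Prefers P y x → y ∈ σ.used
  last : ∀ y ∈ σ.held, ∀ x ∈ σ.used, M.doc x = M.doc y → x ≠ y → M.Prefers P x y

theorem GDAInvariant.held_subset {σ : GDAState H X} (h : M.GDAInvariant P σ) :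
    σ.held ⊆ σ.used := h.held_eq ▸ choose_subset _

theorem GDAInvariant.eq_of_doc_eq {σ : GDAState H X} (h : M.GDAInvariant P σ) {x y : X}
    (hx : x ∈ σ.held) (hy : y ∈ σ.held) (hd : M.doc x = M.doc y) : x = y := by
  by_contra hne
  exact Prefers.irrefl _ ((h.last y hy x (h.held_subset hx) hd hne).trans
    (h.last x hx y (h.held_subset hy) hd.symm (Ne.symm hne)))

theorem gdaInvariant_init : M.GDAInvariant P gdaInit where
  held_eq := choose_empty.symm
  mem_prop := by simp [gdaInit]
  nodup_prop := by simp [gdaInit]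
  acceptable := by simp [gdaInit]
  closed := by simp [gdaInit]
  last := by simp [gdaInit]

theorem GDAInvariant.isMatching {σ : GDAState H X} (h : M.GDAInvariant P σ) :
    M.IsMatching σ.held := by
  refine ⟨fun x hx y hy => h.eq_of_doc_eq hx hy, fun k => ?_⟩
  rw [h.held_eq]
  exact totalSize_choose_le_one _ k

theorem GDAInvariant.assigned_eq {σ : GDAState H X} (h : M.GDAInvariant P σ) {x : X} {d : D}
    (hd : M.doc x = d) (hx : x ∈ σ.held) : M.assigned σ.held d = some ⟨x, hd⟩ :=
  assigned_eq_some hd hx fun _ hy hyd => h.eq_of_doc_eq hy hx (hyd.trans hd.symm)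

/-- A proposal of `x` replaces the chosen set from `σ.used` by the one from `σ.used ∪ {x}`. -/
theorem GDAInvariant.held_propose {σ : GDAState H X} (h : M.GDAInvariant P σ) {x : X}
    (hx : x ∉ σ.used) {Y : Finset X}
    (hY : ∀ y, y ∈ Y ↔ y ∈ M.sizeGreedy (σ.prop (M.hosp x) ++ [x]) ∨
      y ∈ σ.held ∧ M.hosp y ≠ M.hosp x) : Y = M.choose (insert x σ.used) := by
  classical
  ext y
  have hn : (σ.prop (M.hosp x) ++ [x]).Nodup := by
    rw [List.nodup_append]
    refine ⟨h.nodup_prop _, by simp, fun a ha b hb => ?_⟩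
    rintro rfl
    rw [List.mem_singleton.1 hb] at ha
    exact hx ((h.mem_prop _ _).1 ha).1
  have hh : ∀ y ∈ σ.prop (M.hosp x) ++ [x], M.hosp y = M.hosp x := by
    intro y hy
    rcases List.mem_append.1 hy with hy | hy
    · exact ((h.mem_prop _ _).1 hy).2
    · rw [List.mem_singleton.1 hy]
  have hS : (σ.prop (M.hosp x) ++ [x]).toFinset
      = {y ∈ insert x σ.used | M.hosp y = M.hosp x} := by
    ext z
    simp only [List.toFinset_append, Finset.mem_union, List.mem_toFinset, h.mem_prop,
      List.mem_singleton, Finset.mem_filter, Finset.mem_insert]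
    constructor
    · rintro (⟨h1, h2⟩ | rfl)
      · exact ⟨.inr h1, h2⟩
      · exact ⟨.inl rfl, rfl⟩
    · rintro ⟨rfl | h1, h2⟩
      · exact .inr rfl
      · exact .inl ⟨h1, h2⟩
  rw [hY, sizeGreedy_eq_choose _ hn hh, hS, h.held_eq]
  simp only [mem_choose, Finset.mem_filter]
  by_cases hyx : M.hosp y = M.hosp x
  · have : M.load {z ∈ insert x σ.used | M.hosp z = M.hosp x} y
        = M.load (insert x σ.used) y := by
      unfold load
      rw [Finset.filter_filter]
      congr 1
      ext z
      simp only [Finset.mem_filter]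
      grind
    simp [hyx, this]
  · have : M.load (insert x σ.used) y = M.load σ.used y := by
      rw [load_insert hx, if_neg (fun h => hyx h.1.symm), add_zero]
    have hne : y ≠ x := by rintro rfl; exact hyx rfl
    simp [hyx, this, hne]

variable [Fintype X]

/-- The effect of an iteration of the algorithm, up to extensionality. -/
theorem GDAStep.exists_proposal {ch : H → List X → Finset X} {σ τ : GDAState H X}
    (hs : M.GDAStep ch P σ τ) : ∃ x, x ∉ σ.used ∧ M.Acceptable P x ∧
      (∀ y ∈ σ.held, M.doc y ≠ M.doc x) ∧
      (∀ y, y ∉ σ.used → M.doc y = M.doc x → y ≠ x → M.Prefers P x y) ∧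
      τ.used = insert x σ.used ∧
      (∀ y, y ∈ τ.held ↔ y ∈ ch (M.hosp x) (σ.prop (M.hosp x) ++ [x]) ∨
        y ∈ σ.held ∧ M.hosp y ≠ M.hosp x) ∧
      τ.prop (M.hosp x) = σ.prop (M.hosp x) ++ [x] ∧
      ∀ h, h ≠ M.hosp x → τ.prop h = σ.prop h := by
  obtain ⟨d, x, hun, hbest⟩ := hs
  obtain ⟨hxS, rfl, hacc, hbest⟩ := docChoice_eq_singleton_iff.1 hbest
  refine ⟨x, by simpa using hxS, hacc, hun, fun y hy => hbest y (by simp [hy]), ?_, ?_, ?_, ?_⟩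
  · ext; simp
  · simp
  · simp
  · intro h hne
    simp [hne]

theorem GDAInvariant.step {σ τ : GDAState H X} (h : M.GDAInvariant P σ)
    (hs : M.GDAStep (fun _ => M.sizeGreedy) P σ τ) : M.GDAInvariant P τ := by
  classical
  obtain ⟨x, hxS, hacc, hun, hbest, hused, hheld, hprop, hprop'⟩ := hs.exists_proposal
  have held := h.held_propose hxS hheld
  have hsub : ∀ y ∈ τ.held, y = x ∨ y ∈ σ.held := fun y hy => by
    rw [held] at hy
    rcases Finset.mem_insert.1 (choose_subset _ hy) with rfl | hyu
    · exact .inl rfl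
    · exact .inr (h.held_eq ▸ mem_choose_of_subset (Finset.subset_insert _ _) hyu hy)
  refine ⟨by rw [held, hused], fun h' y => ?_, fun h' => ?_, ?_, ?_, ?_⟩
  · rw [hused]
    rcases eq_or_ne h' (M.hosp x) with rfl | hne
    · simp only [hprop, List.mem_append, h.mem_prop, List.mem_singleton, Finset.mem_insert]
      grind
    · simp only [hprop' _ hne, h.mem_prop, Finset.mem_insert]
      grind
  · rcases eq_or_ne h' (M.hosp x) with rfl | hne
    · rw [hprop, List.nodup_append]
      refine ⟨h.nodup_prop _, by simp, fun a ha b hb => ?_⟩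
      rintro rfl
      rw [List.mem_singleton.1 hb] at ha
      exact hxS ((h.mem_prop _ _).1 ha).1
    · rw [hprop' _ hne]
      exact h.nodup_prop _
  · rw [hused]
    intro y hy
    rcases Finset.mem_insert.1 hy with rfl | hy
    · exact hacc
    · exact h.acceptable y hy
  · rw [hused]
    intro y hy z hz
    refine Finset.mem_insert.2 ?_
    rcases Finset.mem_insert.1 hy with rfl | hy
    · by_contra! hzu
      exact Prefers.irrefl _ (hz.trans (hbest z hzu.2 hz.doc_eq hzu.1))
    · exact .inr (h.closed y hy z hz)
  · rw [hused]
    intro y hy z hz hd hne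
    rcases Finset.mem_insert.1 hz with rfl | hz'
    · rcases hsub y hy with rfl | hy
      · exact absurd rfl hne
      · exact absurd hd.symm (hun y hy)
    · rcases hsub y hy with rfl | hy
      · exact (Prefers.total hd hne).resolve_right fun hyz => hxS (h.closed z hz' y hyz)
      · exact h.last y hy z hz' hd hne

theorem GDAInvariant.of_reachable {σ : GDAState H X}
    (h : Relation.ReflTransGen (M.GDAStep (fun _ => M.sizeGreedy) P) gdaInit σ) :
    M.GDAInvariant P σ := by
  induction h with
  | refl => exact gdaInvariant_init
  | tail _ hs ih => exact ih.step hs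

theorem exists_step_iff {σ : GDAState H X} {ch : H → List X → Finset X} :
    (∃ τ, M.GDAStep ch P σ τ) ↔
      ∃ x, M.Acceptable P x ∧ x ∉ σ.used ∧ ∀ y ∈ σ.held, M.doc y ≠ M.doc x := by
  classical
  constructor
  · rintro ⟨_, d, x, hun, hbest⟩
    obtain ⟨hxS, rfl, hacc, -⟩ := docChoice_eq_singleton_iff.1 hbest
    exact ⟨x, hacc, by simpa using hxS, hun⟩
  · rintro ⟨x, hacc, hx, hun⟩
    obtain ⟨y, hy⟩ := exists_docChoice_eq_singleton (S := Finset.univ \ σ.used)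
      (by simpa using hx) rfl hacc
    exact ⟨_, .propose σ _ y hun (by convert hy)⟩

/-- Every proposal uses up a contract, so that the algorithm ends. -/
theorem exists_isGDAOutput (P : M.Profile) :
    ∃ Y, M.IsGDAOutput (fun _ => M.sizeGreedy) P Y := by
  classical
  have key : ∀ (k : ℕ) (σ : GDAState H X), (Finset.univ \ σ.used).card ≤ k →
      Relation.ReflTransGen (M.GDAStep (fun _ => M.sizeGreedy) P) gdaInit σ →
      ∃ Y, M.IsGDAOutput (fun _ => M.sizeGreedy) P Y := by
    intro k
    induction k with
    | zero =>
      intro σ hk hσ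
      refine ⟨σ.held, σ, hσ, ?_, rfl⟩
      rw [exists_step_iff]
      rintro ⟨x, -, hx, -⟩
      rw [Nat.le_zero, Finset.card_eq_zero] at hk
      exact absurd (Finset.mem_sdiff.2 ⟨Finset.mem_univ x, hx⟩) (by rw [hk]; simp)
    | succ k ih =>
      intro σ hk hσ
      by_cases hs : ∃ τ, M.GDAStep (fun _ => M.sizeGreedy) P σ τ
      · obtain ⟨τ, hs⟩ := hs
        refine ih τ ?_ (hσ.tail hs)
        obtain ⟨x, hx, -, -, -, hused, -⟩ := hs.exists_proposal
        rw [hused]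
        refine Nat.le_of_lt_succ (lt_of_lt_of_le (Finset.card_lt_card
          (Finset.ssubset_iff_subset_ne.2 ⟨?_, fun h => ?_⟩)) hk)
        · exact Finset.sdiff_subset_sdiff le_rfl (Finset.subset_insert _ _)
        · have : x ∈ Finset.univ \ insert x σ.used := by rw [h]; simpa using hx
          simp at this
      · exact ⟨σ.held, σ, hσ, hs, rfl⟩
  exact key _ gdaInit le_rfl .refl

/-- A contract that a doctor prefers to her final one has been proposed (and rejected). -/
theorem GDAInvariant.mem_used_of_rel_assigned {σ : GDAState H X} (h : M.GDAInvariant P σ)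
    (hfin : ¬ ∃ τ, M.GDAStep (fun _ => M.sizeGreedy) P σ τ) {x : X}
    (hx : (P (M.doc x)).rel (some ⟨x, rfl⟩) (M.assigned σ.held (M.doc x))) : x ∈ σ.used := by
  by_cases hm : ∃ y ∈ σ.held, M.doc y = M.doc x
  · obtain ⟨y, hy, hd⟩ := hm
    rw [h.assigned_eq hd hy, rel_some_iff] at hx
    exact h.closed y (h.held_subset hy) x hx
  · push Not at hm
    rw [assigned_eq_none hm] at hx
    by_contra hxu
    exact hfin (exists_step_iff.2 ⟨x, hx, hxu, hm⟩)

/-- If some contract of a blocking coalition is not held, then it has been rejected, and therefore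
more than `1 - maxSize` of the budget is spent; a coalition can spend at most `1`. -/
theorem GDAInvariant.isStable {σ : GDAState H X} (h : M.GDAInvariant P σ)
    (hfin : ¬ ∃ τ, M.GDAStep (fun _ => M.sizeGreedy) P σ τ) (hM : M.Proportional)
    (hs : M.maxSize < 1) : M.IsStable P (1 / (1 - M.maxSize)) σ.held := by
  classical
  refine ⟨h.isMatching, ?_⟩
  rintro ⟨k, Z, ⟨-, hZle⟩, hZk, hZP, hlt⟩
  obtain ⟨β, hβ, hu⟩ := hM
  have hm0 : 0 ≤ M.maxSize := Real.iSup_nonneg M.size_nonneg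
  have hpos : 0 < 1 - M.maxSize := by linarith
  have hα : 1 ≤ 1 / (1 - M.maxSize) := by rw [le_div_iff₀ hpos]; linarith
  have hutil : ∀ Y : Finset X, (∀ y ∈ Y, M.hosp y = k) →
      ∑ y ∈ Y, M.util y = β k * ∑ y ∈ Y, M.size y := by
    intro Y hY
    rw [Finset.mul_sum]
    exact Finset.sum_congr rfl fun y hy => by rw [hu, hY y hy]
  by_cases hsub : Z ⊆ σ.held
  · have h1 : ∑ x ∈ Z, M.util x ≤ ∑ x ∈ σ.held with M.hosp x = k, M.util x :=
      Finset.sum_le_sum_of_subset_of_nonneg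
        (fun z hz => Finset.mem_filter.2 ⟨hsub hz, hZk z hz⟩) fun _ _ _ => M.util_nonneg _
    have h0 : 0 ≤ ∑ x ∈ σ.held with M.hosp x = k, M.util x :=
      Finset.sum_nonneg fun _ _ => M.util_nonneg _
    nlinarith
  · obtain ⟨x, hxZ, hx⟩ := Finset.not_subset.1 hsub
    have hxu := h.mem_used_of_rel_assigned hfin (hZP x hxZ hx)
    have h1 := one_lt_totalSize_add_of_notMem hxu (h.held_eq ▸ hx)
    rw [← h.held_eq, hZk x hxZ] at h1
    have h2 : M.size x ≤ M.maxSize := le_ciSup (Finite.bddAbove_range M.size) x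
    have h3 : ∑ z ∈ Z, M.size z ≤ 1 := by
      simpa [Finset.filter_true_of_mem hZk] using hZle k
    rw [hutil _ hZk, hutil _ (by simp)] at hlt
    have h4 : 1 - M.maxSize < ∑ x ∈ σ.held with M.hosp x = k, M.size x := by
      have : M.totalSize σ.held k = ∑ x ∈ σ.held with M.hosp x = k, M.size x := rfl
      linarith
    have h5 : β k ≤ 1 / (1 - M.maxSize) * (β k * ∑ x ∈ σ.held with M.hosp x = k, M.size x) := by
      rw [div_mul_eq_mul_div, one_mul, le_div_iff₀ hpos]
      exact mul_le_mul_of_nonneg_left h4.le (hβ k).le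
    have h6 := mul_le_mul_of_nonneg_left h3 (hβ k).le
    linarith

end Invariant

section StrategyProofness

variable [LinearOrder X] [Fintype X] {M : Market D H X}

/-- If no doctor has an acceptable contract outside of `A` that she prefers to her contract in the
choice from `A`, then nothing outside of `A` is ever proposed: the first such proposal would have
been preceded by the rejection of a contract that is chosen even from `A`. -/
theorem used_subset_of_stable {P : M.Profile} {A : Finset X}
    (hA : ∀ x, M.Acceptable P x → x ∉ A → ∃ z ∈ M.choose A, M.Prefers P z x)
    {σ : GDAState H X}
    (hσ : Relation.ReflTransGen (M.GDAStep (fun _ => M.sizeGreedy) P) gdaInit σ) :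
    σ.used ⊆ A := by
  classical
  induction hσ with
  | refl => simp [gdaInit]
  | @tail σ τ hσ hs ih =>
    have h := GDAInvariant.of_reachable hσ
    obtain ⟨x, -, hacc, hun, hbest, hused, -⟩ := hs.exists_proposal
    have : x ∈ A := by
      by_contra hx
      obtain ⟨z, hz, hzx⟩ := hA x hacc hx
      have hzu : z ∉ σ.used := fun hzu =>
        hun z (h.held_eq ▸ mem_choose_of_subset ih hzu hz) hzx.doc_eq
      have hne : z ≠ x := by rintro rfl; exact Prefers.irrefl _ hzx
      exact Prefers.irrefl _ (hzx.trans (hbest z hzu hzx.doc_eq hne))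
    rw [hused]
    intro y hy
    rcases Finset.mem_insert.1 hy with rfl | hy
    · exact this
    · exact ih hy

/-- In a final state, an acceptable contract that was not proposed is worse than the one held. -/
theorem GDAInvariant.exists_prefers_of_notMem {P : M.Profile} {σ : GDAState H X}
    (h : M.GDAInvariant P σ) (hfin : ¬ ∃ τ, M.GDAStep (fun _ => M.sizeGreedy) P σ τ) {x : X}
    (hx : M.Acceptable P x) (hxu : x ∉ σ.used) : ∃ z ∈ M.choose σ.used, M.Prefers P z x := by
  rw [exists_step_iff] at hfin
  push Not at hfin
  obtain ⟨z, hz, hd⟩ := hfin x hx hxu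
  have hzu := h.held_subset hz
  have hne : z ≠ x := by rintro rfl; exact hxu hzu
  exact ⟨z, h.held_eq ▸ hz,
    (Prefers.total hd hne).resolve_right fun hp => hxu (h.closed z hzu x hp)⟩

/-- If `d` ends up with `z` in some run, and reports another preference for which all the
contracts preferred to `z` were proposed in that run, then she gets `z` or better. -/
theorem exists_held_of_run {P P' : M.Profile} {d : D} (hPP' : ∀ d', d' ≠ d → P' d' = P d')
    {σ σ' : GDAState H X}
    (hσ : Relation.ReflTransGen (M.GDAStep (fun _ => M.sizeGreedy) P) gdaInit σ)
    (hfin : ¬ ∃ τ, M.GDAStep (fun _ => M.sizeGreedy) P σ τ)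
    (hσ' : Relation.ReflTransGen (M.GDAStep (fun _ => M.sizeGreedy) P') gdaInit σ')
    (hfin' : ¬ ∃ τ, M.GDAStep (fun _ => M.sizeGreedy) P' σ' τ)
    {z : X} (hz : z ∈ σ'.held) (hzd : M.doc z = d) (hacc : M.Acceptable P z)
    (hbetter : ∀ w, M.Prefers P w z → w ∈ σ'.used) :
    ∃ y ∈ σ.held, M.doc y = d ∧ (y = z ∨ M.Prefers P y z) := by
  have h := GDAInvariant.of_reachable hσ
  have h' := GDAInvariant.of_reachable hσ'
  have hsub : σ.used ⊆ σ'.used := by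
    refine used_subset_of_stable (fun x hx hxu => ?_) hσ
    by_cases hxd : M.doc x = d
    · refine ⟨z, h'.held_eq ▸ hz, ?_⟩
      have hne : z ≠ x := by rintro rfl; exact hxu (h'.held_subset hz)
      exact (Prefers.total (hzd.trans hxd.symm) hne).resolve_right fun hp => hxu (hbetter x hp)
    · obtain ⟨y, hy, hyx⟩ := h'.exists_prefers_of_notMem hfin'
        ((acceptable_congr (hPP' _ hxd)).2 hx) hxu
      refine ⟨y, hy, (prefers_congr (hPP' _ ?_)).1 hyx⟩
      rw [hyx.doc_eq]
      exact hxd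
  by_cases hzu : z ∈ σ.used
  · refine ⟨z, ?_, hzd, .inl rfl⟩
    rw [h.held_eq]
    exact mem_choose_of_subset hsub hzu (h'.held_eq ▸ hz)
  · obtain ⟨y, hy, hyz⟩ := h.exists_prefers_of_notMem hfin hacc hzu
    exact ⟨y, h.held_eq ▸ hy, hyz.doc_eq.trans hzd, .inr hyz⟩

/-- A doctor who stays unmatched gets nothing either when she declares fewer contracts acceptable.
Otherwise one more doctor would be matched, while fewer contracts are proposed, contradicting the
law of aggregate demand. -/
theorem unmatched_of_unmatched {P P' : M.Profile} {d : D}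
    (hPP' : ∀ d', d' ≠ d → P' d' = P d') {σ σ' : GDAState H X}
    (hσ : Relation.ReflTransGen (M.GDAStep (fun _ => M.sizeGreedy) P) gdaInit σ)
    (hfin : ¬ ∃ τ, M.GDAStep (fun _ => M.sizeGreedy) P σ τ)
    (hσ' : Relation.ReflTransGen (M.GDAStep (fun _ => M.sizeGreedy) P') gdaInit σ')
    (hfin' : ¬ ∃ τ, M.GDAStep (fun _ => M.sizeGreedy) P' σ' τ)
    (hacc : ∀ x, M.doc x = d → M.Acceptable P x → M.Acceptable P' x)
    (hd : ∀ y ∈ σ'.held, M.doc y ≠ d) : ∀ y ∈ σ.held, M.doc y ≠ d := by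
  classical
  have h := GDAInvariant.of_reachable hσ
  have h' := GDAInvariant.of_reachable hσ'
  have hsub : σ.used ⊆ σ'.used := by
    refine used_subset_of_stable (fun x hx hxu => ?_) hσ
    by_cases hxd : M.doc x = d
    · exact absurd (exists_step_iff.2 ⟨x, hacc x hxd hx, hxu, hxd ▸ hd⟩) hfin'
    · obtain ⟨y, hy, hyx⟩ := h'.exists_prefers_of_notMem hfin'
        ((acceptable_congr (hPP' _ hxd)).2 hx) hxu
      refine ⟨y, hy, (prefers_congr (hPP' _ ?_)).1 hyx⟩
      rw [hyx.doc_eq]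
      exact hxd
  have hcard : σ.held.card ≤ σ'.held.card := by
    rw [h.held_eq, h'.held_eq]
    exact card_choose_mono hsub
  have hinj : (σ.held.image M.doc).card = σ.held.card :=
    Finset.card_image_of_injOn fun x hx y hy => h.eq_of_doc_eq hx hy
  have hinj' : (σ'.held.image M.doc).card = σ'.held.card :=
    Finset.card_image_of_injOn fun x hx y hy => h'.eq_of_doc_eq hx hy
  have himage : σ'.held.image M.doc ⊆ σ.held.image M.doc := by
    intro c hc
    obtain ⟨y, hy, rfl⟩ := Finset.mem_image.1 hc
    have hyd := hd y hy
    by_cases hyu : y ∈ σ.used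
    · refine Finset.mem_image_of_mem _ ?_
      rw [h.held_eq]
      exact mem_choose_of_subset hsub hyu (h'.held_eq ▸ hy)
    · have hyP := (acceptable_congr (hPP' _ hyd)).1 (h'.acceptable y (h'.held_subset hy))
      obtain ⟨z, hz, hzy⟩ := h.exists_prefers_of_notMem hfin hyP hyu
      exact Finset.mem_image.2 ⟨z, h.held_eq ▸ hz, hzy.doc_eq⟩
  have heq := Finset.eq_of_subset_of_card_le himage (by rw [hinj, hinj']; exact hcard)
  intro y hy hyd
  have : d ∈ σ'.held.image M.doc := heq ▸ Finset.mem_image.2 ⟨y, hy, hyd⟩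
  obtain ⟨z, hz, hzd⟩ := Finset.mem_image.1 this
  exact hd z hz hzd

theorem IsGDAMechanism.strategyProof {f : M.Profile → Finset X}
    (hf : M.IsGDAMechanism (fun _ => M.sizeGreedy) f) : M.StrategyProof f := by
  intro P P' d hPP' hrel
  obtain ⟨σ, hσ, hfin, hσf⟩ := hf P
  obtain ⟨σ', hσ', hfin', hσf'⟩ := hf P'
  rw [← hσf, ← hσf'] at hrel
  have h := GDAInvariant.of_reachable hσ
  have h' := GDAInvariant.of_reachable hσ'
  -- nothing is preferred to the outcome of the truth except a contract
  have hnone : ∀ a, (P d).rel a (M.assigned σ.held d) → (P d).rel a none := by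
    intro a ha
    by_cases hm : ∃ y ∈ σ.held, M.doc y = d
    · obtain ⟨y, hy, hd⟩ := hm
      rw [h.assigned_eq hd hy] at ha
      exact (P d).trans _ _ _ ha ((rel_some_none_iff hd).2 (h.acceptable y (h.held_subset hy)))
    · push Not at hm
      rwa [assigned_eq_none hm] at ha
  by_cases hm' : ∃ x ∈ σ'.held, M.doc x = d
  swap
  · push Not at hm'
    rw [assigned_eq_none hm'] at hrel
    exact (P d).irrefl _ (hnone _ hrel)
  obtain ⟨x, hx, hxd⟩ := hm'
  rw [h'.assigned_eq hxd hx] at hrel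
  have hxacc : M.Acceptable P x := (rel_some_none_iff hxd).1 (hnone _ hrel)
  -- `d` does not get `x` or better when she tells the truth
  have hworse : ∀ y ∈ σ.held, M.doc y = d → ¬ (y = x ∨ M.Prefers P y x) := by
    intro y hy hyd hyx
    rw [h.assigned_eq hyd hy, rel_some_iff] at hrel
    rcases hyx with rfl | hyx
    · exact Prefers.irrefl _ hrel
    · exact Prefers.irrefl _ (hrel.trans hyx)
  set S : Set X := {w | w = x ∨ M.Prefers P w x} with hS
  have hxS : x ∈ S := .inl rfl
  obtain ⟨-, σ₁, hσ₁, hfin₁, -⟩ := exists_isGDAOutput (M.keepOnly P d S)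
  obtain ⟨-, σ₂, hσ₂, hfin₂, -⟩ := exists_isGDAOutput (M.keepOnly P d {x})
  have h₁ := GDAInvariant.of_reachable hσ₁
  have hP₁ : ∀ d', d' ≠ d → M.keepOnly P d S d' = P d' := fun _ hd' => keepOnly_of_ne hd'
  -- when she accepts only `x`, she gets it, because the misreport led to it
  obtain ⟨y, hy, hyd, hyx⟩ : ∃ y ∈ σ₂.held, M.doc y = d ∧
      (y = x ∨ M.Prefers (M.keepOnly P d {x}) y x) := by
    refine exists_held_of_run (fun d' hd' => ?_) hσ₂ hfin₂ hσ' hfin' hx hxd ?_ ?_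
    · rw [hPP' d' hd', keepOnly_of_ne hd']
    · rw [acceptable_keepOnly hxd]
      rfl
    · intro w hw
      have := hw.acceptable ((acceptable_keepOnly hxd).2 rfl)
      rw [acceptable_keepOnly (hw.doc_eq.trans hxd), Set.mem_singleton_iff] at this
      subst this
      exact absurd hw (Prefers.irrefl _)
  -- when she accepts only `x` and what is better, she gets nothing, because the truth leads to
  -- something worse
  have hun : ∀ z ∈ σ₁.held, M.doc z ≠ d := by
    intro z hz hzd
    have hzS : z ∈ S := (acceptable_keepOnly hzd).1 (h₁.acceptable z (h₁.held_subset hz))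
    have hzacc : M.Acceptable P z := by
      rcases hzS with rfl | hzx
      · exact hxacc
      · exact hzx.acceptable hxacc
    obtain ⟨y, hy, hyd, hyz⟩ := exists_held_of_run hP₁ hσ hfin hσ₁ hfin₁ hz hzd hzacc fun w hw => by
      refine h₁.closed z (h₁.held_subset hz) w
        ((prefers_keepOnly (hw.doc_eq.trans hzd) ?_ hzS).2 hw)
      rcases hzS with rfl | hzx
      · exact .inr hw
      · exact .inr (hw.trans hzx)
    refine hworse y hy hyd ?_
    rcases hyz with rfl | hyz
    · exact hzS
    · rcases hzS with rfl | hzx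
      · exact .inr hyz
      · exact .inr (hyz.trans hzx)
  refine unmatched_of_unmatched (P' := M.keepOnly P d S) (fun d' hd' => ?_) hσ₂ hfin₂ hσ₁ hfin₁
    (fun w hwd hw => ?_) hun y hy hyd
  · rw [keepOnly_of_ne hd', keepOnly_of_ne hd']
  · rw [acceptable_keepOnly hwd] at hw ⊢
    rw [Set.mem_singleton_iff.1 hw]
    exact hxS

end StrategyProofness

end Market

/-! ### Programs, tournaments and linked lists -/

namespace RealRAM

section Logic

@[simp] theorem nat_writeNat (σ : Store) (a i k b j : ℕ) :
    (σ.writeNat a i k).nat b j = if b = a ∧ j = i then k else σ.nat b j := by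
  simp only [Store.writeNat, Function.update_apply]
  split_ifs <;> simp_all

@[simp] theorem nat_writeNat_of_ne (σ : Store) {a b : ℕ} (h : b ≠ a) (i k : ℕ) :
    (σ.writeNat a i k).nat b = σ.nat b := by
  ext j
  simp [h]

@[simp] theorem real_writeNat (σ : Store) (a i k : ℕ) : (σ.writeNat a i k).real = σ.real := rfl

@[simp] theorem nat_writeReal (σ : Store) (a i : ℕ) (r : ℝ) :
    (σ.writeReal a i r).nat = σ.nat := rfl

@[simp] theorem real_writeReal (σ : Store) (a i : ℕ) (r : ℝ) (b j : ℕ) :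
    (σ.writeReal a i r).real b j = if b = a ∧ j = i then r else σ.real b j := by
  simp only [Store.writeReal, Function.update_apply]
  split_ifs <;> simp_all

@[simp] theorem real_writeReal_of_ne (σ : Store) {a b : ℕ} (h : b ≠ a) (i : ℕ) (r : ℝ) :
    (σ.writeReal a i r).real b = σ.real b := by
  ext j
  simp [h]

open Classical in
/-- The final store of a program without loops, computed by structural recursion (a loop would be
skipped). -/
def Prog.result : Prog → Store → Store
  | .skip, σ => σ
  | .setNat a i e, σ => σ.writeNat a (i.eval σ) (e.eval σ)
  | .setReal a i e, σ => σ.writeReal a (i.eval σ) (e.eval σ)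
  | .seq p q, σ => q.result (p.result σ)
  | .cond b p q, σ => if b.holds σ then p.result σ else q.result σ
  | .loop _ _, σ => σ

/-- A bound, independent of the store, for the running time of a program without loops. -/
def Prog.bound : Prog → ℕ
  | .skip => 1
  | .setNat _ i e => i.cost + e.cost + 1
  | .setReal _ i e => i.cost + e.cost + 1
  | .seq p q => p.bound + q.bound
  | .cond b p q => b.cost + (p.bound + q.bound)
  | .loop _ _ => 0

/-- The program contains no loop. -/
def Prog.LoopFree : Prog → Prop
  | .skip => True
  | .setNat _ _ _ => True
  | .setReal _ _ _ => True
  | .seq p q => p.LoopFree ∧ q.LoopFree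
  | .cond _ p q => p.LoopFree ∧ q.LoopFree
  | .loop _ _ => False

theorem Prog.LoopFree.exec {p : Prog} (hp : p.LoopFree) (σ : Store) :
    ∃ t, Exec p σ (p.result σ) t ∧ t ≤ p.bound := by
  induction p generalizing σ with
  | skip => exact ⟨_, .skip σ, le_rfl⟩
  | setNat a i e => exact ⟨_, .setNat σ a i e, le_rfl⟩
  | setReal a i e => exact ⟨_, .setReal σ a i e, le_rfl⟩
  | seq p q ihp ihq =>
    obtain ⟨t, h, ht⟩ := ihp hp.1 σ
    obtain ⟨t', h', ht'⟩ := ihq hp.2 (p.result σ)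
    exact ⟨_, .seq h h', by simp only [Prog.bound]; omega⟩
  | cond b p q ihp ihq =>
    by_cases hb : b.holds σ
    · obtain ⟨t, h, ht⟩ := ihp hp.1 σ
      refine ⟨_, .condTrue hb (τ := _) (t := t) ?_, by simp only [Prog.bound]; omega⟩
      simpa [Prog.result, hb] using h
    · obtain ⟨t, h, ht⟩ := ihq hp.2 σ
      refine ⟨_, .condFalse hb (τ := _) (t := t) ?_, by simp only [Prog.bound]; omega⟩
      simpa [Prog.result, hb] using h
  | loop => exact hp.elim

theorem result_seq (p q : Prog) (σ : Store) :
    (Prog.seq p q).result σ = q.result (p.result σ) := rfl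

theorem Test.cost_pos (b : Test) : 0 < b.cost := by
  cases b <;> simp [Test.cost]

/-- Total correctness of a loop: `I σ k` is an invariant in which `k` is a bound for the remaining
time. -/
theorem exec_loop_of_credit {b : Test} {p : Prog} (I : Store → ℕ → Prop)
    (body : ∀ σ k, I σ k → b.holds σ →
      ∃ τ t k', Exec p σ τ t ∧ I τ k' ∧ b.cost + t + k' ≤ k)
    {σ : Store} {k : ℕ} (hσ : I σ k) :
    ∃ τ t k', Exec (.loop b p) σ τ t ∧ t ≤ k + b.cost ∧ I τ k' ∧ ¬ b.holds τ := by
  induction k using Nat.strong_induction_on generalizing σ with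
  | _ k ih =>
    by_cases hb : b.holds σ
    · obtain ⟨τ, t, k', he, hI, ht⟩ := body σ k hσ hb
      have := b.cost_pos
      obtain ⟨υ, t', k'', he', ht', hI', hb'⟩ := ih k' (by omega) hI
      exact ⟨υ, _, k'', .loopTrue hb he he', by omega, hI', hb'⟩
    · exact ⟨σ, _, k, .loopFalse hb, by omega, hσ, hb⟩

/-- Total correctness of a loop with invariant `I`, where the potential `Φ` pays for the time. -/
theorem exec_loop {b : Test} {p : Prog} (I : Store → Prop) (Φ : Store → ℕ)
    (body : ∀ σ, I σ → b.holds σ → ∃ τ t, Exec p σ τ t ∧ I τ ∧ b.cost + t + Φ τ ≤ Φ σ)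
    {σ : Store} (hσ : I σ) :
    ∃ τ t, Exec (.loop b p) σ τ t ∧ t ≤ Φ σ + b.cost ∧ I τ ∧ ¬ b.holds τ := by
  obtain ⟨τ, t, _, he, ht, hI, hb⟩ := exec_loop_of_credit (b := b) (p := p)
    (fun σ k => I σ ∧ k = Φ σ) (fun σ k ⟨hI, hk⟩ hb => by
      obtain ⟨τ, t, he, hI', ht⟩ := body σ hI hb
      exact ⟨τ, t, _, he, ⟨hI', rfl⟩, hk ▸ ht⟩) ⟨hσ, rfl⟩
  exact ⟨τ, t, he, ht, hI.1, hb⟩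

end Logic

section Tournament

/-- The better of two players of a tournament, where `0` stands for an absent player. -/
def best (le : ℕ → ℕ → Prop) [DecidableRel le] (l r : ℕ) : ℕ :=
  if l = 0 then r else if r = 0 then l else if le l r then l else r

variable {le : ℕ → ℕ → Prop} [DecidableRel le]

theorem best_eq_or (l r : ℕ) : best le l r = l ∨ best le l r = r := by
  unfold best
  split_ifs <;> simp

theorem best_left (htot : ∀ a b, le a b ∨ le b a) {l r : ℕ} (hl : l ≠ 0) :
    best le l r ≠ 0 ∧ le (best le l r) l := by
  unfold best
  have := htot l l
  have := htot l r
  split_ifs <;> simp_all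

theorem best_right (htot : ∀ a b, le a b ∨ le b a) {l r : ℕ} (hr : r ≠ 0) :
    best le l r ≠ 0 ∧ le (best le l r) r := by
  unfold best
  have := htot r r
  have := htot l r
  split_ifs <;> simp_all

/-- In a tournament tree with nodes `1, …, 2 * n - 1`, where `2 * k` and `2 * k + 1` are the
children of `k` and the last `n` nodes are leaves, the root is a best player. -/
theorem root_best (htot : ∀ a b, le a b ∨ le b a) (htrans : ∀ a b c, le a b → le b c → le a c)
    {n : ℕ} {T : ℕ → ℕ} {A : Finset ℕ} (hA : A ⊆ Finset.Icc 1 n)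
    (htree : ∀ k, 1 ≤ k → k < n → T k = best le (T (k + k)) (T (k + k + 1)))
    (hleaf : ∀ c, 1 ≤ c → c ≤ n → T (n + c - 1) = if c ∈ A then c else 0) (hne : A.Nonempty) :
    T 1 ∈ A ∧ ∀ c ∈ A, le (T 1) c := by
  have h1 : ∀ m k, 2 * n ≤ k + m → 1 ≤ k → k < 2 * n → T k = 0 ∨ T k ∈ A := by
    intro m
    induction m with
    | zero => intros; omega
    | succ m ih =>
      intro k hm hk hkn
      rcases Nat.lt_or_ge k n with h | h
      · have hl := ih (k + k) (by omega) (by omega) (by omega)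
        have hr := ih (k + k + 1) (by omega) (by omega) (by omega)
        rw [htree k hk h]
        rcases best_eq_or (le := le) (T (k + k)) (T (k + k + 1)) with h | h <;> rw [h]
        · exact hl
        · exact hr
      · have := hleaf (k + 1 - n) (by omega) (by omega)
        rw [show n + (k + 1 - n) - 1 = k by omega] at this
        split_ifs at this with hc
        · rw [this]; exact .inr hc
        · exact .inl this
  have h2 : ∀ k, 1 ≤ k → k < 2 * n → T k ≠ 0 → T 1 ≠ 0 ∧ le (T 1) (T k) := by
    intro k
    induction k using Nat.strong_induction_on with
    | _ k ih =>
      intro hk hkn h0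
      rcases eq_or_ne k 1 with rfl | hk1
      · exact ⟨h0, (htot _ _).elim id id⟩
      · have hj := htree (k / 2) (by omega) (by omega)
        have hb : T (k / 2) ≠ 0 ∧ le (T (k / 2)) (T k) := by
          rcases (by omega : k = k / 2 + k / 2 ∨ k = k / 2 + k / 2 + 1) with h | h
          · rw [← h] at hj
            rw [hj]
            exact best_left htot h0
          · rw [← h] at hj
            rw [hj]
            exact best_right htot h0
        obtain ⟨h3, h4⟩ := ih (k / 2) (by omega) (by omega) (by omega) hb.1
        exact ⟨h3, htrans _ _ _ h4 hb.2⟩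
  have h3 : ∀ c ∈ A, T 1 ≠ 0 ∧ le (T 1) c := by
    intro c hc
    have hcn := Finset.mem_Icc.1 (hA hc)
    have := hleaf c hcn.1 hcn.2
    rw [if_pos hc] at this
    have h4 := h2 (n + c - 1) (by omega) (by omega) (by omega)
    rwa [this] at h4
  obtain ⟨c, hc⟩ := hne
  have hcn := Finset.mem_Icc.1 (hA hc)
  exact ⟨(h1 (2 * n) 1 (by omega) le_rfl (by omega)).resolve_left (h3 c hc).1,
    fun c hc => (h3 c hc).2⟩

end Tournament

section LinkedLists

/-- The list of the nonzero numbers found when starting from `c` and following the pointers `nx`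
up to the first `0`. -/
def Chain (nx : ℕ → ℕ) : ℕ → List ℕ → Prop
  | c, [] => c = 0
  | c, b :: l => c = b ∧ b ≠ 0 ∧ Chain nx (nx b) l

theorem Chain.congr {nx nx' : ℕ → ℕ} {l : List ℕ} (h : ∀ b ∈ l, nx' b = nx b) {c : ℕ}
    (hc : Chain nx c l) : Chain nx' c l := by
  induction l generalizing c with
  | nil => exact hc
  | cons b l ih =>
    obtain ⟨h1, h2, h3⟩ := hc
    refine ⟨h1, h2, ?_⟩
    rw [h b (by simp)]
    exact ih (fun b' hb' => h b' (by simp [hb'])) h3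

theorem Chain.drop {nx : ℕ → ℕ} {l₁ l₂ : List ℕ} {b c : ℕ} (h : Chain nx c (l₁ ++ b :: l₂)) :
    Chain nx (nx b) l₂ := by
  induction l₁ generalizing c with
  | nil => exact h.2.2
  | cons a l₁ ih => exact ih h.2.2

end LinkedLists

section Programs

/-- The number of contracts, an input. -/
abbrev numExpr : NExpr := .get 0 (.const 0)

/-- The scalar variables are the cells of the array `8`. -/
abbrev var (k : ℕ) : NExpr := .get 8 (.const k)

/-- Assign the value of `e` to the variable `k`. -/
abbrev setVar (k : ℕ) (e : NExpr) : Prog := .setNat 8 (.const k) e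

/-- The test `i < n`, where `n` is the number of contracts and `i` is variable `0`. -/
abbrev moreTest : Test := .neg (.nle numExpr (var 0))

/-- The test `2 ≤ k`, where `k` is variable `1`. -/
abbrev notRootTest : Test := .nle (.const 2) (var 1)

/-- Put the players `1, …, n` on the leaves `n, …, 2 * n - 1` of the tournament tree. -/
def leafBody : Prog :=
  .seq (.setNat 6 (.add numExpr (var 0)) (.add (var 0) (.const 1)))
    (setVar 0 (.add (var 0) (.const 1)))

/-- Recompute the node `k` of the tournament tree from its children, where `k` is variable `1`.
The test `cmp` compares the players in the variables `2` and `3`. -/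
def matchProg (cmp : Test) : Prog :=
  .seq (setVar 2 (.get 6 (.add (var 1) (var 1)))) <|
  .seq (setVar 3 (.get 6 (.add (.add (var 1) (var 1)) (.const 1)))) <|
  .cond (.nle (var 2) (.const 0)) (.setNat 6 (var 1) (var 3)) <|
  .cond (.nle (var 3) (.const 0)) (.setNat 6 (var 1) (var 2)) <|
  .cond cmp (.setNat 6 (var 1) (var 2)) (.setNat 6 (var 1) (var 3))

/-- Play the next match, from the last to the first node.  Since the machine cannot divide, the
parents of the nodes are tabulated in array `7`. -/
def buildBody (cmp : Test) : Prog :=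
  .seq (setVar 1 (.sub (var 1) (.const 1))) <|
  .seq (.setNat 7 (.add (var 1) (var 1)) (var 1)) <|
  .seq (.setNat 7 (.add (.add (var 1) (var 1)) (.const 1)) (var 1)) <|
  matchProg cmp

/-- Go to the parent and replay its match. -/
def repairBody (cmp : Test) : Prog :=
  .seq (setVar 1 (.get 7 (var 1))) (matchProg cmp)

/-- Remove the winner `c` of the tournament, and, if it passes the test `filt`, push it on the
linked list of its group, which is read off in the array `g`.  The array `hd` holds the heads of the
lists and `nx` the pointers. -/
def extractProg (filt : Test) (g hd nx : ℕ) : Prog :=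
  .seq (setVar 4 (.get 6 (.const 1))) <|
  .seq (setVar 1 (.sub (.add numExpr (var 4)) (.const 1))) <|
  .seq (.setNat 6 (var 1) (.const 0)) <|
  .seq (.cond filt
    (.seq (.setNat nx (var 4) (.get hd (.get g (.sub (var 4) (.const 1)))))
      (.setNat hd (.get g (.sub (var 4) (.const 1))) (var 4))) .skip) <|
  setVar 0 (.add (var 0) (.const 1))

/-- Sort the contracts with a tournament, and distribute them to linked lists.  Since each winner is
pushed at the front, the lists are in decreasing order. -/
def listsProg (cmp filt : Test) (g hd nx : ℕ) : Prog :=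
  .seq (.seq (setVar 0 (.const 0)) (.loop moreTest leafBody)) <|
  .seq (.seq (setVar 1 numExpr) (.loop notRootTest (buildBody cmp))) <|
  .seq (setVar 0 (.const 0)) <|
  .loop moreTest (.seq (extractProg filt g hd nx) (.loop notRootTest (repairBody cmp)))

/-- `σ` and `τ` agree except possibly on the arrays of natural numbers in `S`. -/
def AgreeOff (S : Set ℕ) (σ τ : Store) : Prop := τ.real = σ.real ∧ ∀ a ∉ S, τ.nat a = σ.nat a

theorem AgreeOff.refl (S : Set ℕ) (σ : Store) : AgreeOff S σ σ := ⟨rfl, fun _ _ => rfl⟩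

theorem AgreeOff.trans {S : Set ℕ} {σ τ υ : Store} (h : AgreeOff S σ τ) (h' : AgreeOff S τ υ) :
    AgreeOff S σ υ := ⟨h'.1.trans h.1, fun a ha => (h'.2 a ha).trans (h.2 a ha)⟩

theorem AgreeOff.mono {S S' : Set ℕ} {σ τ : Store} (h : AgreeOff S σ τ) (hS : S ⊆ S') :
    AgreeOff S' σ τ := ⟨h.1, fun a ha => h.2 a fun h => ha (hS h)⟩

theorem AgreeOff.writeNat {S : Set ℕ} {σ τ : Store} (h : AgreeOff S σ τ) {a : ℕ} (ha : a ∈ S)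
    (i k : ℕ) : AgreeOff S σ (τ.writeNat a i k) := by
  refine ⟨h.1, fun b hb => funext fun j => ?_⟩
  have : b ≠ a := fun h => hb (h ▸ ha)
  simp [this, h.2 b hb]

theorem matchProg_loopFree (cmp : Test) : (matchProg cmp).LoopFree := by
  simp [matchProg, Prog.LoopFree]

variable {cmp filt : Test} {le : ℕ → ℕ → Prop} [DecidableRel le] {S : Set ℕ} {σ₀ : Store}

/-- The effect of a match, if `cmp` computes `le`. -/
theorem matchProg_spec (h8 : 8 ∈ S)
    (hcmp : ∀ σ, AgreeOff S σ₀ σ → (cmp.holds σ ↔ le (σ.nat 8 2) (σ.nat 8 3)))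
    {σ : Store} (hσ : AgreeOff S σ₀ σ) :
    AgreeOff {6, 8} σ ((matchProg cmp).result σ) ∧
    (∀ j, ((matchProg cmp).result σ).nat 6 j = if j = σ.nat 8 1 then
      best le (σ.nat 6 (σ.nat 8 1 + σ.nat 8 1)) (σ.nat 6 (σ.nat 8 1 + σ.nat 8 1 + 1))
      else σ.nat 6 j) ∧
    ∀ i, i ≠ 2 → i ≠ 3 → ((matchProg cmp).result σ).nat 8 i = σ.nat 8 i := by
  set k := σ.nat 8 1 with hk
  set τ := (σ.writeNat 8 2 (σ.nat 6 (k + k))).writeNat 8 3 (σ.nat 6 (k + k + 1)) with hτ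
  have hτS : AgreeOff S σ₀ τ := (hσ.writeNat h8 _ _).writeNat h8 _ _
  have hτ' : AgreeOff {6, 8} σ τ :=
    ((AgreeOff.refl _ σ).writeNat (by simp) _ _).writeNat (by simp) _ _
  have hres : (matchProg cmp).result σ
      = τ.writeNat 6 k (best le (σ.nat 6 (k + k)) (σ.nat 6 (k + k + 1))) := by
    have h2 : τ.nat 8 2 = σ.nat 6 (k + k) := by simp [τ]
    have h3 : τ.nat 8 3 = σ.nat 6 (k + k + 1) := by simp [τ]
    have h1 : τ.nat 8 1 = k := by simp [τ, hk]
    have hc := hcmp τ hτS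
    rw [h2, h3] at hc
    have hstart : ((setVar 3 (.get 6 (.add (.add (var 1) (var 1)) (.const 1)))).result
        ((setVar 2 (.get 6 (.add (var 1) (var 1)))).result σ)) = τ := by
      simp [Prog.result, NExpr.eval, τ, hk]
    simp only [matchProg]
    rw [result_seq, result_seq, hstart]
    simp only [Prog.result, Test.holds, NExpr.eval, h1, h2, h3, hc, best, Nat.le_zero]
    split_ifs <;> rfl
  rw [hres]
  refine ⟨hτ'.writeNat (by simp) _ _, fun j => ?_, fun i hi2 hi3 => ?_⟩
  · simp [τ]
  · simp [τ, hi2, hi3]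

end Programs

end RealRAM

/-! ### Running a tournament -/

namespace RealRAM

section Sorting

theorem exec_leaves (σ : Store) :
    ∃ τ t, Exec (.seq (setVar 0 (.const 0)) (.loop moreTest leafBody)) σ τ t ∧
      t ≤ (moreTest.cost + leafBody.bound) * σ.nat 0 0 + moreTest.cost + 3 ∧
      AgreeOff {6, 8} σ τ ∧ ∀ c, 1 ≤ c → c ≤ σ.nat 0 0 → τ.nat 6 (σ.nat 0 0 + c - 1) = c := by
  set n := σ.nat 0 0 with hn
  have hfree : leafBody.LoopFree := by simp [leafBody, Prog.LoopFree]
  obtain ⟨τ, t, he, ht, ⟨h1, h2, h3⟩, hb⟩ := exec_loop (b := moreTest) (p := leafBody)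
    (fun υ => AgreeOff {6, 8} σ υ ∧ υ.nat 8 0 ≤ n ∧ ∀ j < υ.nat 8 0, υ.nat 6 (n + j) = j + 1)
    (fun υ => (moreTest.cost + leafBody.bound) * (n - υ.nat 8 0))
    (fun υ ⟨h1, h2, h3⟩ hb => by
      have hN : υ.nat 0 0 = n := by rw [h1.2 0 (by simp)]
      simp only [Test.holds, NExpr.eval, hN, not_le] at hb
      obtain ⟨t, he, ht⟩ := hfree.exec υ
      refine ⟨_, t, he, ⟨?_, ?_, ?_⟩, ?_⟩
      · exact (h1.writeNat (by simp) _ _).writeNat (by simp) _ _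
      · simp [leafBody, Prog.result, NExpr.eval]
        omega
      · intro j hj
        simp [leafBody, Prog.result, NExpr.eval, hN] at hj ⊢
        split_ifs with h
        · rw [h]
        · exact h3 j (by omega)
      · have : (leafBody.result υ).nat 8 0 = υ.nat 8 0 + 1 := by
          simp [leafBody, Prog.result, NExpr.eval]
        rw [this]
        obtain ⟨m, hm⟩ : ∃ m, n - υ.nat 8 0 = m + 1 := ⟨n - υ.nat 8 0 - 1, by omega⟩
        rw [hm, show n - (υ.nat 8 0 + 1) = m by omega, mul_add, mul_one]
        omega)
    (σ := σ.writeNat 8 0 0)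
    ⟨(AgreeOff.refl _ _).writeNat (by simp) _ _, by simp, by simp⟩
  refine ⟨τ, _, .seq (.setNat σ 8 _ _) he, ?_, h1, fun c hc hcn => ?_⟩
  · simp only [nat_writeNat, and_self, if_true, Nat.sub_zero] at ht
    simp only [NExpr.cost]
    omega
  · have hN : τ.nat 0 0 = n := by rw [h1.2 0 (by simp)]
    simp only [Test.holds, NExpr.eval, hN, not_not] at hb
    have := h3 (c - 1) (by omega)
    rwa [show n + (c - 1) = n + c - 1 by omega, show c - 1 + 1 = c by omega] at this

variable {cmp filt : Test} {le : ℕ → ℕ → Prop} [DecidableRel le] {S : Set ℕ} {σ₀ : Store}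

/-- Playing all the matches from the last node to the root. -/
theorem exec_build (h6 : 6 ∈ S) (h7 : 7 ∈ S) (h8 : 8 ∈ S) (h0 : 0 ∉ S)
    (hcmp : ∀ σ, AgreeOff S σ₀ σ → (cmp.holds σ ↔ le (σ.nat 8 2) (σ.nat 8 3)))
    {σ : Store} (hσ : AgreeOff S σ₀ σ) {n : ℕ} (hn : σ₀.nat 0 0 = n) :
    ∃ τ t, Exec (.seq (setVar 1 numExpr) (.loop notRootTest (buildBody cmp))) σ τ t ∧
      t ≤ (notRootTest.cost + (buildBody cmp).bound) * n + notRootTest.cost + 4 ∧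
      AgreeOff {6, 7, 8} σ τ ∧ (∀ j, n ≤ j → τ.nat 6 j = σ.nat 6 j) ∧
      (∀ q, 2 ≤ q → q < 2 * n → τ.nat 7 q = q / 2) ∧
      ∀ k, 1 ≤ k → k < n → τ.nat 6 k = best le (τ.nat 6 (k + k)) (τ.nat 6 (k + k + 1)) := by
  have hfree : (buildBody cmp).LoopFree := by simp [buildBody, Prog.LoopFree, matchProg_loopFree]
  have hN : σ.nat 0 0 = n := by rw [hσ.2 0 h0, hn]
  have hsub : ({6, 7, 8} : Set ℕ) ⊆ S := by
    rintro a (rfl | rfl | rfl) <;> assumption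
  obtain ⟨τ, t, he, ht, ⟨h1, h2, h3, h4, h5⟩, hb⟩ := exec_loop (b := notRootTest)
    (p := buildBody cmp)
    (fun υ => AgreeOff {6, 7, 8} σ υ ∧ υ.nat 8 1 ≤ n ∧ (∀ j, n ≤ j → υ.nat 6 j = σ.nat 6 j) ∧
      (∀ q, 2 * υ.nat 8 1 ≤ q → q < 2 * n → υ.nat 7 q = q / 2) ∧
      ∀ k, υ.nat 8 1 ≤ k → k < n → υ.nat 6 k = best le (υ.nat 6 (k + k)) (υ.nat 6 (k + k + 1)))
    (fun υ => (notRootTest.cost + (buildBody cmp).bound) * υ.nat 8 1)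
    (fun υ ⟨h1, h2, h3, h4, h5⟩ hb => by
      simp only [Test.holds, NExpr.eval] at hb
      obtain ⟨t, he, ht⟩ := hfree.exec υ
      obtain ⟨m, hm⟩ : ∃ m, υ.nat 8 1 = m + 1 := ⟨υ.nat 8 1 - 1, by omega⟩
      set ω := ((υ.writeNat 8 1 m).writeNat 7 (m + m) m).writeNat 7 (m + m + 1) m with hω
      have hres : (buildBody cmp).result υ = (matchProg cmp).result ω := by
        simp only [buildBody, result_seq]
        congr 1
        simp [Prog.result, NExpr.eval, hm, ω]
      have hωS : AgreeOff {6, 7, 8} σ ω :=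
        ((h1.writeNat (by simp) _ _).writeNat (by simp) _ _).writeNat (by simp) _ _
      obtain ⟨g1, g2, g3⟩ := matchProg_spec h8 hcmp (hσ.trans (hωS.mono hsub))
      have hω1 : ω.nat 8 1 = m := by simp [ω]
      have hω6 : ω.nat 6 = υ.nat 6 := by ext j; simp [ω]
      rw [hω1, hω6] at g2
      have hr1 : ((buildBody cmp).result υ).nat 8 1 = m := by
        rw [hres, g3 1 (by simp) (by simp), hω1]
      refine ⟨_, t, he, ⟨?_, ?_, ?_, ?_, ?_⟩, ?_⟩
      · rw [hres]
        exact hωS.trans (g1.mono (by grind))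
      · omega
      · intro j hj
        rw [hres, g2, if_neg (by omega), h3 j hj]
      · intro q hq hqn
        rw [hr1] at hq
        rw [hres, g1.2 7 (by simp)]
        simp only [hω, nat_writeNat, true_and]
        have h48 : ¬ (7 = 8 ∧ q = 1) := by omega
        split_ifs with h h'
        · omega
        · omega
        · exact h4 q (by omega) hqn
      · intro k hk hkn
        rw [hr1] at hk
        rw [hres, g2, g2 (k + k), g2 (k + k + 1), if_neg (by omega : ¬ k + k = m),
          if_neg (by omega : ¬ k + k + 1 = m)]
        split_ifs with hkm
        · rw [hkm]
        · exact h5 k (by omega) hkn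
      · rw [hr1, hm, mul_add, mul_one]
        omega)
    (σ := σ.writeNat 8 1 n)
    ⟨(AgreeOff.refl _ _).writeNat (by simp) _ _, by simp, by simp, by simp; omega,
      by simp; omega⟩
  simp only [Test.holds, NExpr.eval] at hb
  have he' : Exec (.loop notRootTest (buildBody cmp))
      (σ.writeNat 8 ((NExpr.const 1).eval σ) (numExpr.eval σ)) τ t := by
    simpa [NExpr.eval, hN] using he
  refine ⟨τ, _, .seq (.setNat σ 8 _ _) he', ?_, h1, h3, fun q hq => h4 q (by omega),
    fun k hk => h5 k (by omega)⟩
  simp only [nat_writeNat, and_self, if_true] at ht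
  simp only [NExpr.cost]
  omega

/-- If only the match at the parent of the node in variable `1` is outdated, then the tournament is
repaired by replaying the matches on the way to the root. -/
theorem exec_repair (h6 : 6 ∈ S) (h8 : 8 ∈ S)
    (hcmp : ∀ σ, AgreeOff S σ₀ σ → (cmp.holds σ ↔ le (σ.nat 8 2) (σ.nat 8 3)))
    {σ : Store} (hσ : AgreeOff S σ₀ σ) {n : ℕ}
    (hpar : ∀ q, 2 ≤ q → q < 2 * n → σ.nat 7 q = q / 2)
    (hp : 1 ≤ σ.nat 8 1) (hpn : σ.nat 8 1 < 2 * n)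
    (htree : ∀ k, 1 ≤ k → k < n → k ≠ σ.nat 8 1 / 2 →
      σ.nat 6 k = best le (σ.nat 6 (k + k)) (σ.nat 6 (k + k + 1))) :
    ∃ τ t, Exec (.loop notRootTest (repairBody cmp)) σ τ t ∧
      t ≤ (notRootTest.cost + (repairBody cmp).bound) * Nat.log 2 (2 * n) + notRootTest.cost ∧
      AgreeOff {6, 8} σ τ ∧ (∀ j, n ≤ j → τ.nat 6 j = σ.nat 6 j) ∧ τ.nat 8 0 = σ.nat 8 0 ∧
      ∀ k, 1 ≤ k → k < n → τ.nat 6 k = best le (τ.nat 6 (k + k)) (τ.nat 6 (k + k + 1)) := by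
  have hfree : (repairBody cmp).LoopFree := by simp [repairBody, Prog.LoopFree, matchProg_loopFree]
  have hsub : ({6, 8} : Set ℕ) ⊆ S := by
    rintro a (rfl | rfl) <;> assumption
  obtain ⟨τ, t, he, ht, ⟨h1, h2, h2', h3, h3', h5⟩, hb⟩ := exec_loop (b := notRootTest)
    (p := repairBody cmp)
    (fun υ => AgreeOff {6, 8} σ υ ∧ 1 ≤ υ.nat 8 1 ∧ υ.nat 8 1 < 2 * n ∧
      (∀ j, n ≤ j → υ.nat 6 j = σ.nat 6 j) ∧ υ.nat 8 0 = σ.nat 8 0 ∧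
      ∀ k, 1 ≤ k → k < n → k ≠ υ.nat 8 1 / 2 →
        υ.nat 6 k = best le (υ.nat 6 (k + k)) (υ.nat 6 (k + k + 1)))
    (fun υ => (notRootTest.cost + (repairBody cmp).bound) * Nat.log 2 (υ.nat 8 1))
    (fun υ ⟨h1, h2, h2', h3, h3', h5⟩ hb => by
      simp only [Test.holds, NExpr.eval] at hb
      obtain ⟨t, he, ht⟩ := hfree.exec υ
      set p := υ.nat 8 1 with hp
      set ω := υ.writeNat 8 1 (p / 2) with hω
      have hhalf : υ.nat 7 p = p / 2 := by rw [h1.2 7 (by simp), hpar p hb h2']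
      have hres : (repairBody cmp).result υ = (matchProg cmp).result ω := by
        simp only [repairBody, result_seq]
        congr 1
        simp [Prog.result, NExpr.eval, ω, ← hp, hhalf]
      have hωS : AgreeOff {6, 8} σ ω := h1.writeNat (by simp) _ _
      obtain ⟨g1, g2, g3⟩ := matchProg_spec h8 hcmp (hσ.trans (hωS.mono hsub))
      have hω1 : ω.nat 8 1 = p / 2 := by simp [ω]
      have hω6 : ω.nat 6 = υ.nat 6 := by ext j; simp [ω]
      rw [hω1, hω6] at g2
      have hr1 : ((repairBody cmp).result υ).nat 8 1 = p / 2 := by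
        rw [hres, g3 1 (by simp) (by simp), hω1]
      refine ⟨_, t, he, ⟨?_, ?_, ?_, ?_, ?_, ?_⟩, ?_⟩
      · rw [hres]
        exact hωS.trans g1
      · omega
      · omega
      · intro j hj
        rw [hres, g2, if_neg (by omega), h3 j hj]
      · rw [hres, g3 0 (by simp) (by simp)]
        simpa [ω] using h3'
      · intro k hk hkn hkp
        rw [hr1] at hkp
        rw [hres, g2, g2 (k + k), g2 (k + k + 1), if_neg (by omega : ¬ k + k = p / 2),
          if_neg (by omega : ¬ k + k + 1 = p / 2)]
        split_ifs with hkm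
        · rw [hkm]
        · exact h5 k hk hkn hkm
      · rw [hr1]
        have : Nat.log 2 p = Nat.log 2 (p / 2) + 1 := by
          rw [Nat.log_div_base]
          have := Nat.log_pos one_lt_two hb
          omega
        rw [this, mul_add, mul_one]
        omega)
    (σ := σ) ⟨AgreeOff.refl _ _, hp, hpn, by simp, rfl, htree⟩
  simp only [Test.holds, NExpr.eval] at hb
  refine ⟨τ, t, he, ht.trans ?_, h1, h3, h3', fun k hk hkn => h5 k hk hkn (by omega)⟩
  gcongr

end Sorting

end RealRAM

/-! ### Sorting into linked lists -/

namespace RealRAM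

section Sorting

variable {cmp filt : Test} {le : ℕ → ℕ → Prop} [DecidableRel le] {F : ℕ → Prop} {σ₀ : Store}
  {n g hd nx : ℕ}

/-- The arrays that are changed by `listsProg`. -/
def scratch (hd nx : ℕ) : Set ℕ := {a | a = 6 ∨ a = 7 ∨ a = 8 ∨ a = hd ∨ a = nx}

/-- What holds when the players in `A` are still in the tournament and the other players that
satisfy `F` have been pushed on the lists. -/
structure ListsInvariant (le : ℕ → ℕ → Prop) [DecidableRel le] (F : ℕ → Prop) (σ₀ : Store)
    (n g hd nx : ℕ) (A : Finset ℕ) (σ : Store) : Prop where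
  agree : AgreeOff (scratch hd nx) σ₀ σ
  subset : A ⊆ Finset.Icc 1 n
  parent : ∀ q, 2 ≤ q → q < 2 * n → σ.nat 7 q = q / 2
  leaf : ∀ c, 1 ≤ c → c ≤ n → σ.nat 6 (n + c - 1) = if c ∈ A then c else 0
  lists : ∀ v, ∃ l, Chain (σ.nat nx) (σ.nat hd v) l ∧ l.Pairwise (fun a b => le b a) ∧ l.Nodup ∧
    ∀ c, c ∈ l ↔ c ∈ Finset.Icc 1 n ∧ c ∉ A ∧ F c ∧ σ₀.nat g (c - 1) = v
  le_alive : ∀ c ∈ Finset.Icc 1 n, c ∉ A → ∀ a ∈ A, le c a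

theorem extractProg_loopFree (filt : Test) (g hd nx : ℕ) :
    (extractProg filt g hd nx).LoopFree := by
  simp [extractProg, Prog.LoopFree]

/-- Removing the winner `c` keeps the invariant, and only the match at the parent of the leaf of `c`
becomes outdated. -/
theorem ListsInvariant.extract (hg : g ≤ 5) (hhd : 9 ≤ hd) (hnx : 9 ≤ nx) (hne : hd ≠ nx)
    (hn : σ₀.nat 0 0 = n)
    (hfilt : ∀ σ, AgreeOff (scratch hd nx) σ₀ σ → (filt.holds σ ↔ F (σ.nat 8 4)))
    {A : Finset ℕ} {σ : Store} (h : ListsInvariant le F σ₀ n g hd nx A σ) {c : ℕ}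
    (hc : σ.nat 6 1 = c) (hcA : c ∈ A) (hbest : ∀ a ∈ A, le c a) :
    ListsInvariant le F σ₀ n g hd nx (A.erase c) ((extractProg filt g hd nx).result σ) ∧
    ((extractProg filt g hd nx).result σ).nat 8 0 = σ.nat 8 0 + 1 ∧
    ((extractProg filt g hd nx).result σ).nat 8 1 = n + c - 1 ∧
    ∀ j, j ≠ n + c - 1 → ((extractProg filt g hd nx).result σ).nat 6 j = σ.nat 6 j := by
  classical
  set S := scratch hd nx with hS
  have h6 : 6 ∈ S := by simp [hS, scratch]
  have h8 : 8 ∈ S := by simp [hS, scratch]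
  have hhdS : hd ∈ S := by simp [hS, scratch]
  have hnxS : nx ∈ S := by simp [hS, scratch]
  have hN : σ.nat 0 0 = n := by
    rw [h.agree.2 0 (by simp [scratch]; omega), hn]
  have hG : σ.nat g = σ₀.nat g := h.agree.2 g (by simp [scratch]; omega)
  have hcn := Finset.mem_Icc.1 (h.subset hcA)
  set ω := ((σ.writeNat 8 4 c).writeNat 8 1 (n + c - 1)).writeNat 6 (n + c - 1) 0 with hω
  have hωS : AgreeOff S σ₀ ω :=
    ((h.agree.writeNat h8 _ _).writeNat h8 _ _).writeNat h6 _ _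
  have hfω := hfilt ω hωS
  rw [show ω.nat 8 4 = c by simp [ω]] at hfω
  set v := σ₀.nat g (c - 1) with hv
  have hstart : (extractProg filt g hd nx).result σ = if F c then
      ((ω.writeNat nx c (σ.nat hd v)).writeNat hd v c).writeNat 8 0 (σ.nat 8 0 + 1)
      else ω.writeNat 8 0 (σ.nat 8 0 + 1) := by
    have h1 : (((setVar 4 (.get 6 (.const 1))).seq
        ((setVar 1 (.sub (.add numExpr (var 4)) (.const 1))).seq
        (.setNat 6 (var 1) (.const 0)))).result σ) = ω := by
      simp [Prog.result, NExpr.eval, ω, hN, hc]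
    have hg8 : g ≠ 8 := by omega
    have hg6 : g ≠ 6 := by omega
    have hgnx : g ≠ nx := by omega
    have h80 : ω.nat 8 0 = σ.nat 8 0 := by simp [ω]
    have h84 : ω.nat 8 4 = c := by simp [ω]
    have hωg : ω.nat g (c - 1) = v := by simp [ω, hg8, hg6, hG, hv]
    have hωhd : ω.nat hd v = σ.nat hd v := by
      simp [ω, show hd ≠ 8 by omega, show hd ≠ 6 by omega]
    simp only [result_seq] at h1
    simp only [extractProg, result_seq]
    rw [h1]
    simp only [Prog.result, hfω]
    split_ifs with hF
    · simp [NExpr.eval, h80, h84, hωg, hωhd, hgnx, show (8 : ℕ) ≠ hd by omega,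
        show (8 : ℕ) ≠ nx by omega]
    · simp [NExpr.eval, h80]
  set τ := (extractProg filt g hd nx).result σ with hτ
  have hnx8 : nx ≠ 8 := by omega
  have hnx6 : nx ≠ 6 := by omega
  have hhd8 : hd ≠ 8 := by omega
  have hhd6 : hd ≠ 6 := by omega
  have hτ6 : ∀ j, τ.nat 6 j = if j = n + c - 1 then 0 else σ.nat 6 j := by
    intro j
    rw [hstart]
    split_ifs <;> simp_all [ω, hnx6.symm, hhd6.symm]
  have hτ7 : ∀ j, τ.nat 7 j = σ.nat 7 j := by
    intro j
    rw [hstart]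
    split_ifs <;> simp [ω, show 7 ≠ nx by omega, show 7 ≠ hd by omega]
  have hτnx : ∀ j, τ.nat nx j = if F c ∧ j = c then σ.nat hd v else σ.nat nx j := by
    intro j
    rw [hstart]
    by_cases hF : F c <;> simp [ω, hF, hnx8, hnx6, hne.symm]
  have hτhd : ∀ j, τ.nat hd j = if F c ∧ j = v then c else σ.nat hd j := by
    intro j
    rw [hstart]
    by_cases hF : F c <;> simp [ω, hF, hhd8, hhd6, hne]
  refine ⟨⟨?_, ?_, ?_, ?_, ?_, ?_⟩, ?_, ?_, ?_⟩
  · rw [hstart]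
    split_ifs
    · exact ((hωS.writeNat hnxS _ _).writeNat hhdS _ _).writeNat h8 _ _
    · exact hωS.writeNat h8 _ _
  · exact (Finset.erase_subset _ _).trans h.subset
  · intro q hq hqn
    rw [hτ7, h.parent q hq hqn]
  · intro b hb hbn
    rw [hτ6, h.leaf b hb hbn]
    rcases eq_or_ne b c with rfl | hbc
    · simp
    · rw [if_neg (by omega)]
      simp [hbc]
  · intro w
    obtain ⟨l, hl, hsort, hnodup, hmem⟩ := h.lists w
    have hcl : c ∉ l := fun hcl => ((hmem c).1 hcl).2.1 hcA
    have hl' : Chain (τ.nat nx) (σ.nat hd w) l := by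
      refine hl.congr fun b hb => ?_
      rw [hτnx, if_neg]
      rintro ⟨-, rfl⟩
      exact hcl hb
    by_cases hw : F c ∧ w = v
    · refine ⟨c :: l, ⟨?_, by omega, ?_⟩, ?_, ?_, fun b => ?_⟩
      · rw [hτhd, if_pos hw]
      · rw [hτnx, if_pos ⟨hw.1, rfl⟩, ← hw.2]
        exact hl'
      · refine List.pairwise_cons.2 ⟨fun b hb => ?_, hsort⟩
        have := (hmem b).1 hb
        exact h.le_alive b this.1 this.2.1 c hcA
      · exact List.nodup_cons.2 ⟨hcl, hnodup⟩
      · rw [List.mem_cons, hmem, Finset.mem_erase]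
        rcases eq_or_ne b c with rfl | hbc
        · simp only [true_or, ne_eq, not_true, false_and, not_false_iff, true_and, true_iff]
          exact ⟨h.subset hcA, hw.1, by rw [hw.2]⟩
        · simp [hbc]
    · refine ⟨l, ?_, hsort, hnodup, fun b => ?_⟩
      · rw [hτhd, if_neg hw]
        exact hl'
      · rw [hmem, Finset.mem_erase]
        rcases eq_or_ne b c with rfl | hbc
        · simp only [hcA, not_true, ne_eq, false_and, and_false, not_false_iff, true_and,
            false_iff]
          rintro ⟨-, hF, rfl⟩
          exact hw ⟨hF, rfl⟩
        · simp [hbc]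
  · intro b hb hbA a ha
    rw [Finset.mem_erase] at hbA ha
    rcases eq_or_ne b c with rfl | hbc
    · exact hbest a ha.2
    · exact h.le_alive b hb (fun h => hbA ⟨hbc, h⟩) a ha.2
  · rw [hstart]
    split_ifs <;> simp
  · rw [hstart]
    split_ifs <;> simp [ω, hnx8.symm, hhd8.symm]
  · intro j hj
    rw [hτ6, if_neg hj]

/-- The specification of `listsProg`; the logarithm in the running time is the height of the
tournament tree. -/
theorem exec_lists (cmp filt : Test) (hg : g ≤ 5) (hhd : 9 ≤ hd) (hnx : 9 ≤ nx) (hne : hd ≠ nx) :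
    ∃ K : ℕ, ∀ (le : ℕ → ℕ → Prop) (F : ℕ → Prop) (σ₀ : Store) (n : ℕ),
      (∀ a b, le a b ∨ le b a) → (∀ a b c, le a b → le b c → le a c) →
      σ₀.nat 0 0 = n → (∀ v, σ₀.nat hd v = 0) →
      (∀ σ, AgreeOff (scratch hd nx) σ₀ σ → (cmp.holds σ ↔ le (σ.nat 8 2) (σ.nat 8 3))) →
      (∀ σ, AgreeOff (scratch hd nx) σ₀ σ → (filt.holds σ ↔ F (σ.nat 8 4))) →
      ∃ τ t, Exec (listsProg cmp filt g hd nx) σ₀ τ t ∧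
        t ≤ K * (n * (Nat.log 2 (2 * n) + 1) + 1) ∧ AgreeOff (scratch hd nx) σ₀ τ ∧
        ∀ v, ∃ l, Chain (τ.nat nx) (τ.nat hd v) l ∧ l.Pairwise (fun a b => le b a) ∧ l.Nodup ∧
          ∀ c, c ∈ l ↔ c ∈ Finset.Icc 1 n ∧ F c ∧ σ₀.nat g (c - 1) = v := by
  classical
  set cR := notRootTest.cost + (repairBody cmp).bound with hcR
  set cE := moreTest.cost + (extractProg filt g hd nx).bound + notRootTest.cost with hcE
  set cL := moreTest.cost + leafBody.bound with hcL
  set cB := notRootTest.cost + (buildBody cmp).bound with hcB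
  set k0 := moreTest.cost + 3 + (notRootTest.cost + 4) + (3 + moreTest.cost) with hk0
  refine ⟨cR + cE + cL + cB + k0, fun le F σ₀ n htot htrans hn hhd0 hcmp hfilt => ?_⟩
  set S := scratch hd nx with hS
  have h6 : 6 ∈ S := by simp [hS, scratch]
  have h7 : 7 ∈ S := by simp [hS, scratch]
  have h8 : 8 ∈ S := by simp [hS, scratch]
  have h0 : 0 ∉ S := by simp [hS, scratch]; omega
  have hsub : ({6, 7, 8} : Set ℕ) ⊆ S := by
    rintro a (rfl | rfl | rfl) <;> assumption
  have hsub' : ({6, 8} : Set ℕ) ⊆ S := by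
    rintro a (rfl | rfl) <;> assumption
  obtain ⟨σ₁, t₁, he₁, ht₁, hA₁, hleaf₁⟩ := exec_leaves σ₀
  rw [hn] at hleaf₁ ht₁
  rw [← hcL] at ht₁
  obtain ⟨σ₂, t₂, he₂, ht₂, hA₂, hT₂, hpar₂, htree₂⟩ :=
    exec_build (σ₀ := σ₀) h6 h7 h8 h0 hcmp (hA₁.mono hsub') hn
  rw [← hcB] at ht₂
  have hS₂ : AgreeOff S σ₀ σ₂ := (hA₁.mono hsub').trans (hA₂.mono hsub)
  have hhd₂ : ∀ v, σ₂.nat hd v = 0 := by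
    intro v
    rw [hA₂.2 hd (by simp; omega), hA₁.2 hd (by simp; omega), hhd0]
  have hinit : ListsInvariant le F σ₀ n g hd nx (Finset.Icc 1 n) (σ₂.writeNat 8 0 0) := by
    refine ⟨hS₂.writeNat h8 _ _, le_rfl, ?_, ?_, ?_, ?_⟩
    · intro q hq hqn
      simp only [nat_writeNat, show ¬ (7 = 8 ∧ q = 0) by omega, if_false]
      exact hpar₂ q hq hqn
    · intro b hb hbn
      simp only [nat_writeNat, show ¬ (6 = 8 ∧ n + b - 1 = 0) by omega, if_false]
      rw [hT₂ _ (by omega), hleaf₁ b hb hbn, if_pos (Finset.mem_Icc.2 ⟨hb, hbn⟩)]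
    · intro v
      refine ⟨[], ?_, .nil, .nil, fun c => ?_⟩
      · simp only [nat_writeNat, show ¬ (hd = 8 ∧ v = 0) by omega, if_false]
        exact hhd₂ v
      · simp only [List.not_mem_nil, false_iff]
        exact fun h => h.2.1 h.1
    · exact fun c hc hc' => absurd hc hc'
  obtain ⟨τ, t₃, he₃, ht₃, ⟨A, hI, hcard, htree⟩, hb⟩ := exec_loop (b := moreTest)
    (p := .seq (extractProg filt g hd nx) (.loop notRootTest (repairBody cmp)))
    (fun υ => ∃ A, ListsInvariant le F σ₀ n g hd nx A υ ∧ A.card + υ.nat 8 0 = n ∧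
      ∀ k, 1 ≤ k → k < n → υ.nat 6 k = best le (υ.nat 6 (k + k)) (υ.nat 6 (k + k + 1)))
    (fun υ => (cE + cR * Nat.log 2 (2 * n)) * (n - υ.nat 8 0))
    (fun υ ⟨A, hI, hcard, htree⟩ hb => by
      have hN : υ.nat 0 0 = n := by rw [hI.agree.2 0 h0, hn]
      simp only [Test.holds, NExpr.eval, hN, not_le] at hb
      obtain ⟨hcA, hbest⟩ := root_best htot htrans hI.subset htree hI.leaf
        (Finset.card_pos.1 (by omega))
      set c := υ.nat 6 1 with hc
      obtain ⟨hI', hi', hp', hT'⟩ := hI.extract hg hhd hnx hne hn hfilt hc.symm hcA hbest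
      have hcn := Finset.mem_Icc.1 (hI.subset hcA)
      obtain ⟨t, he, ht⟩ := (extractProg_loopFree filt g hd nx).exec υ
      set ω := (extractProg filt g hd nx).result υ with hω
      obtain ⟨τ, t', he', ht', hA', hl', h0', htree'⟩ := exec_repair (σ₀ := σ₀) h6 h8 hcmp
        hI'.agree hI'.parent (by omega) (by omega) (by
          intro k hk hkn hkp
          rw [hT' k (by omega), hT' (k + k) (by omega), hT' (k + k + 1) (by omega)]
          exact htree k hk hkn)
      rw [← hcR] at ht'
      refine ⟨τ, _, .seq he he', ⟨A.erase c, ⟨?_, hI'.subset, ?_, ?_, ?_, hI'.le_alive⟩, ?_,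
        htree'⟩, ?_⟩
      · exact hI'.agree.trans (hA'.mono hsub')
      · intro q hq hqn
        rw [hA'.2 7 (by simp)]
        exact hI'.parent q hq hqn
      · intro b hb hbn
        rw [hl' _ (by omega)]
        exact hI'.leaf b hb hbn
      · rw [hA'.2 nx (by simp; omega), hA'.2 hd (by simp; omega)]
        exact hI'.lists
      · rw [h0', hi', Finset.card_erase_of_mem hcA]
        have := Finset.card_pos.2 ⟨c, hcA⟩
        omega
      · rw [h0', hi']
        obtain ⟨m, hm⟩ : ∃ m, n - υ.nat 8 0 = m + 1 := ⟨n - υ.nat 8 0 - 1, by omega⟩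
        rw [hm, show n - (υ.nat 8 0 + 1) = m by omega, mul_add, mul_one]
        omega)
    (σ := σ₂.writeNat 8 0 0) ⟨_, hinit, by simp, by simpa using htree₂⟩
  have hN : τ.nat 0 0 = n := by rw [hI.agree.2 0 h0, hn]
  simp only [Test.holds, NExpr.eval, hN, not_not] at hb
  have hA : A = ∅ := Finset.card_eq_zero.1 (by omega)
  refine ⟨τ, _, .seq he₁ (.seq he₂ (.seq (.setNat σ₂ 8 _ _) he₃)), ?_, hI.agree, fun v => ?_⟩
  · simp only [nat_writeNat, and_self, if_true, Nat.sub_zero] at ht₃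
    simp only [NExpr.cost]
    have h1 : (cR + cE + cL + cB + k0) * (n * (Nat.log 2 (2 * n) + 1) + 1) =
        ((cE + cR * Nat.log 2 (2 * n)) * n + cL * n + cB * n + k0) +
        (cR * n + cE * (n * Nat.log 2 (2 * n)) + cL * (n * Nat.log 2 (2 * n)) +
          cB * (n * Nat.log 2 (2 * n)) + k0 * (n * (Nat.log 2 (2 * n) + 1)) +
          cR + cE + cL + cB) := by ring
    rw [h1]
    omega
  · simpa [hA] using hI.lists v

end Sorting

end RealRAM

/-! ### The deferred acceptance program -/

namespace RealRAM

section DeferredAcceptance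

/-- The test whether the doctor in variable `1` is unmatched (array `14`) and has an acceptable
contract that she has not yet proposed (array `9`). -/
abbrev freeTest : Test :=
  .conj (.nle (.get 14 (var 1)) (.const 0)) (.nle (.const 1) (.get 9 (var 1)))

/-- Go to the doctor of the next contract. -/
def advanceProg : Prog :=
  .seq (setVar 0 (.add (var 0) (.const 1))) (setVar 1 (.get 1 (var 0)))

/-- Store the best contract not yet proposed by the current doctor in variable `2`, and remove it
from her list. -/
def takeProg : Prog :=
  .seq (setVar 2 (.get 9 (var 1))) (.setNat 9 (var 1) (.get 10 (var 2)))

/-- The test whether the proposed contract may be acceptable for its hospital: array `13` marks the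
contracts that are at least as large as some rejected one. -/
abbrev openTest : Test := .nle (.get 13 (var 2)) (.const 0)

/-- Let the hospital of the proposed contract hold it. -/
def holdProg : Prog :=
  .seq (setVar 3 (.get 2 (.sub (var 2) (.const 1)))) <|
  .seq (.setNat 5 (.sub (var 2) (.const 1)) (.const 1)) <|
  .seq (.setNat 14 (var 1) (.const 1)) <|
  .setReal 1 (var 3) (.add (.get 1 (var 3)) (.get 0 (.sub (var 2) (.const 1))))

/-- The test whether the current hospital respects its budget. -/
abbrev fitsTest : Test := .rle (.get 1 (var 3)) (.const 1)

/-- The test whether the contract in variable `4` is not held. -/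
abbrev popTest : Test := .nle (.get 5 (.sub (var 4) (.const 1))) (.const 0)

/-- Close the contract in variable `4`, and go to the next smaller one of the same hospital. -/
def popBody : Prog :=
  .seq (.setNat 13 (var 4) (.const 1)) (setVar 4 (.get 12 (var 4)))

/-- Reject the contract in variable `4`; its doctor becomes the current one. -/
def evictProg : Prog :=
  .seq (.setNat 13 (var 4) (.const 1)) <|
  .seq (.setNat 11 (var 3) (.get 12 (var 4))) <|
  .seq (.setNat 5 (.sub (var 4) (.const 1)) (.const 0)) <|
  .seq (.setReal 1 (var 3) (.sub (.get 1 (var 3)) (.get 0 (.sub (var 4) (.const 1))))) <|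
  .seq (setVar 1 (.get 1 (.sub (var 4) (.const 1)))) <|
  .setNat 14 (var 1) (.const 0)

/-- Find the largest contract that the current hospital holds, and reject it. -/
def shrinkProg : Prog :=
  .seq (setVar 4 (.get 11 (var 3))) (.seq (.loop popTest popBody) evictProg)

/-- One iteration: the current doctor proposes, or it is the turn of the next doctor. -/
def proposeBody : Prog :=
  .cond freeTest
    (.seq takeProg (.cond openTest (.seq holdProg (.cond fitsTest .skip shrinkProg)) .skip))
    advanceProg

/-- Deferred acceptance for given linked lists: array `9` holds the first contract of the list of
each doctor (her best contract not yet proposed), and array `10` the pointers; array `11` holds the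
first contract of the list of each hospital (its largest contract that is not closed), and array
`12` the pointers. -/
def acceptanceProg : Prog :=
  .seq (.seq (setVar 0 (.const 0)) (setVar 1 (.get 1 (.const 0)))) (.loop moreTest proposeBody)

variable {n : ℕ}

/-- The number that represents a contract in linked lists; `0` is the end of a list. -/
def code (x : Fin n) : ℕ := x + 1

theorem code_injective : Function.Injective (code (n := n)) := fun x y h => by
  simpa [code, Fin.ext_iff] using h

@[simp] theorem code_inj {x y : Fin n} : code x = code y ↔ x = y := code_injective.eq_iff

@[simp] theorem code_sub_one (x : Fin n) : code x - 1 = x := rfl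

theorem exists_map_code {l : List ℕ} (h : ∀ c ∈ l, c ∈ Finset.Icc 1 n) :
    ∃ l' : List (Fin n), l'.map code = l := by
  induction l with
  | nil => exact ⟨[], rfl⟩
  | cons c l ih =>
    obtain ⟨l', hl'⟩ := ih fun b hb => h b (by simp [hb])
    have hc := Finset.mem_Icc.1 (h c (by simp))
    exact ⟨⟨c - 1, by omega⟩ :: l', by simp [code, hl']; omega⟩

/-- Starting from the first contract of a list, find the first one that is held. -/
theorem exec_pop (l : List (Fin n)) (σ : Store)
    (hl : Chain (σ.nat 12) (σ.nat 8 4) (l.map code)) (hex : ∃ x ∈ l, σ.nat 5 x ≠ 0) :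
    ∃ (l₁ : List (Fin n)) (m : Fin n) (l₂ : List (Fin n)) (τ : Store) (t : ℕ),
      l = l₁ ++ m :: l₂ ∧ (∀ x ∈ l₁, σ.nat 5 x = 0) ∧ σ.nat 5 m ≠ 0 ∧
      Exec (.loop popTest popBody) σ τ t ∧
      t ≤ (popTest.cost + popBody.bound) * l₁.length + popTest.cost ∧
      AgreeOff {8, 13} σ τ ∧ τ.nat 8 4 = code m ∧ (∀ j, j ≠ 4 → τ.nat 8 j = σ.nat 8 j) ∧
      ∀ x : Fin n, τ.nat 13 (code x) = 0 ↔ σ.nat 13 (code x) = 0 ∧ x ∉ l₁ := by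
  induction l generalizing σ with
  | nil => simp at hex
  | cons y l ih =>
    obtain ⟨h1, h2, h3⟩ := hl
    by_cases hy : σ.nat 5 y = 0
    · have hb : popTest.holds σ := by
        simp [Test.holds, NExpr.eval, h1, hy]
      have hfree : popBody.LoopFree := by simp [popBody, Prog.LoopFree]
      obtain ⟨t, he, ht⟩ := hfree.exec σ
      have hres : popBody.result σ
          = (σ.writeNat 13 (code y) 1).writeNat 8 4 (σ.nat 12 (code y)) := by
        simp [popBody, Prog.result, NExpr.eval, h1]
      rw [hres] at he
      set ω := (σ.writeNat 13 (code y) 1).writeNat 8 4 (σ.nat 12 (code y)) with hω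
      have hω12 : ω.nat 12 = σ.nat 12 := by ext j; simp [ω]
      have hω5 : ω.nat 5 = σ.nat 5 := by ext j; simp [ω]
      have hω84 : ω.nat 8 4 = σ.nat 12 (code y) := by simp [ω]
      have hωA : AgreeOff {8, 13} σ ω :=
        ((AgreeOff.refl _ σ).writeNat (by simp) _ _).writeNat (by simp) _ _
      obtain ⟨l₁, m, l₂, τ, t', rfl, g1, g2, g3, g4, g5, g6, g7, g8⟩ := ih ω
        (by rw [hω12, hω84]; exact h3) (by
          rw [hω5]
          obtain ⟨x, hx, hx5⟩ := hex
          rcases List.mem_cons.1 hx with rfl | hx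
          · exact absurd hy hx5
          · exact ⟨x, hx, hx5⟩)
      rw [hω5] at g1 g2
      refine ⟨y :: l₁, m, l₂, τ, _, rfl, ?_, g2, .loopTrue hb he g3, ?_, hωA.trans g5, g6,
        fun j hj => ?_, fun x => ?_⟩
      · intro x hx
        rcases List.mem_cons.1 hx with rfl | hx
        · exact hy
        · exact g1 x hx
      · rw [List.length_cons, mul_add, mul_one]
        omega
      · rw [g7 j hj]
        simp [ω, hj]
      · rw [g8]
        rcases eq_or_ne x y with rfl | hxy
        · simp [ω]
        · simp [ω, hxy]
    · refine ⟨[], y, l, σ, _, rfl, by simp, hy, .loopFalse ?_, by simp, AgreeOff.refl _ _, h1,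
        fun _ _ => rfl, by simp⟩
      simpa [Test.holds, NExpr.eval, h1] using hy

end DeferredAcceptance

end RealRAM

namespace Market

open RealRAM

variable {nD nH n : ℕ} {M : Market (Fin nD) (Fin nH) (Fin n)} {P : M.Profile}

/-- If `x` is the best contract that its unmatched doctor has not yet proposed, then there is an
iteration in which it is proposed. -/
theorem GDAInvariant.exists_step {S : GDAState (Fin nH) (Fin n)} (h : M.GDAInvariant P S)
    {x : Fin n} (hx : x ∉ S.used) (hacc : M.Acceptable P x)
    (hun : ∀ y ∈ S.held, M.doc y ≠ M.doc x)
    (hbest : ∀ y, y ∉ S.used → M.doc y = M.doc x → y ≠ x → M.Acceptable P y → M.Prefers P x y) :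
    ∃ S', M.GDAStep (fun _ => M.sizeGreedy) P S S' ∧ S'.used = insert x S.used ∧
      S'.held = M.choose (insert x S.used) := by
  classical
  have hchoice : M.docChoice P (M.doc x) (Finset.univ \ S.used) = {x} := by
    refine docChoice_eq_singleton_iff.2 ⟨by simpa using hx, rfl, hacc, fun y hy hd hne => ?_⟩
    by_contra hxy
    have hyx := (Prefers.total hd hne).resolve_right hxy
    exact hxy (hbest y (by simpa using hy) hd hne (hyx.acceptable hacc))
  refine ⟨_, .propose S _ x hun (by convert hchoice), ?_, ?_⟩
  · ext; simp
  · exact h.held_propose hx (by simp)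

/-- The doctor `d` is matched, or has proposed all her acceptable contracts. -/
def Done (M : Market (Fin nD) (Fin nH) (Fin n)) (P : M.Profile) (S : GDAState (Fin nH) (Fin n))
    (d : Fin nD) : Prop :=
  (∃ y ∈ S.held, M.doc y = d) ∨ ∀ x, M.doc x = d → M.Acceptable P x → x ∈ S.used

/-- The store `σ` represents the state `S` of deferred acceptance.  Closed contracts (array `13`) are
not in the lists of the hospitals, and a proposal of one of them would be rejected. -/
structure Represents (M : Market (Fin nD) (Fin nH) (Fin n)) (P : M.Profile)
    (S : GDAState (Fin nH) (Fin n)) (σ : Store) : Prop where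
  reach : Relation.ReflTransGen (M.GDAStep (fun _ => M.sizeGreedy) P) gdaInit S
  num : σ.nat 0 0 = n
  doc : ∀ x : Fin n, σ.nat 1 x = M.doc x
  hosp : ∀ x : Fin n, σ.nat 2 x = M.hosp x
  size : ∀ x : Fin n, σ.real 0 x = M.size x
  held : ∀ x : Fin n, σ.nat 5 x ≠ 0 ↔ x ∈ S.held
  matched : ∀ d : Fin nD, σ.nat 14 d ≠ 0 ↔ ∃ y ∈ S.held, M.doc y = d
  docList : ∀ d : Fin nD, ∃ l : List (Fin n), Chain (σ.nat 10) (σ.nat 9 d) (l.map code) ∧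
    l.Pairwise (M.Prefers P) ∧ ∀ x, x ∈ l ↔ M.doc x = d ∧ M.Acceptable P x ∧ x ∉ S.used
  hospList : ∀ h : Fin nH, ∃ l : List (Fin n), Chain (σ.nat 12) (σ.nat 11 h) (l.map code) ∧
    l.Pairwise (fun a b => M.SizeLE b a ∧ a ≠ b) ∧
    ∀ x, x ∈ l ↔ M.hosp x = h ∧ σ.nat 13 (code x) = 0
  closed : ∀ x : Fin n, σ.nat 13 (code x) ≠ 0 → 1 < M.load (insert x S.used) x
  total : ∀ h : Fin nH, σ.real 1 h = M.totalSize S.held h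

/-- It is the turn of the doctor `d`, and all the other doctors of the contracts `0, …, i` have been
dealt with. -/
structure Progress (M : Market (Fin nD) (Fin nH) (Fin n)) (P : M.Profile)
    (S : GDAState (Fin nH) (Fin n)) (i d : ℕ) : Prop where
  le : i ≤ n
  isDoc : i < n → ∃ x : Fin n, (M.doc x : ℕ) = d
  done : ∀ j : Fin n, (j : ℕ) ≤ i → M.Done P S (M.doc j) ∨ i < n ∧ (M.doc j : ℕ) = d

/-- The contracts that are not closed; each of them can be removed only once. -/
def openSet (n : ℕ) (σ : Store) : Finset (Fin n) := {x | σ.nat 13 (code x) = 0}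

/-- The current doctor, if free, takes her next contract from her list. -/
theorem Represents.take {S : GDAState (Fin nH) (Fin n)} {σ : Store} (h : M.Represents P S σ)
    {d : Fin nD} (hun : σ.nat 14 d = 0) (hne : σ.nat 9 d ≠ 0) :
    ∃ x : Fin n, σ.nat 9 d = code x ∧ M.doc x = d ∧ x ∉ S.used ∧
      (∀ y ∈ S.held, M.doc y ≠ d) ∧
      (∃ S', M.GDAStep (fun _ => M.sizeGreedy) P S S' ∧ S'.used = insert x S.used ∧
        S'.held = M.choose (insert x S.used)) ∧
      ∀ d' : Fin nD, ∃ l : List (Fin n),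
        Chain (σ.nat 10) (if d' = d then σ.nat 10 (code x) else σ.nat 9 d') (l.map code) ∧
        l.Pairwise (M.Prefers P) ∧
        ∀ y, y ∈ l ↔ M.doc y = d' ∧ M.Acceptable P y ∧ y ∉ insert x S.used := by
  have hinv := GDAInvariant.of_reachable h.reach
  obtain ⟨l, hl, hsort, hmem⟩ := h.docList d
  cases l with
  | nil => exact absurd hl hne
  | cons x l =>
    obtain ⟨h1, -, h3⟩ := hl
    obtain ⟨hd, hacc, hx⟩ := (hmem x).1 (by simp)
    rw [List.pairwise_cons] at hsort
    have hun' : ∀ y ∈ S.held, M.doc y ≠ d := fun y hy hyd =>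
      absurd hun ((h.matched d).2 ⟨y, hy, hyd⟩)
    refine ⟨x, h1, hd, hx, hun', ?_, fun d' => ?_⟩
    · refine hinv.exists_step hx hacc (hd ▸ hun') fun y hy hyd hyx hya => ?_
      rcases List.mem_cons.1 ((hmem y).2 ⟨hyd.trans hd, hya, hy⟩) with rfl | hyl
      · exact absurd rfl hyx
      · exact hsort.1 y hyl
    · by_cases hdd : d' = d
      · subst hdd
        rw [if_pos rfl]
        refine ⟨l, h3, hsort.2, fun y => ?_⟩
        have hyl := hmem y
        rw [List.mem_cons] at hyl
        rcases eq_or_ne y x with rfl | hyx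
        · simp only [Finset.mem_insert_self, not_true, and_false, iff_false]
          exact fun hy => Prefers.irrefl _ (hsort.1 y hy)
        · simpa [hyx] using hyl
      · rw [if_neg hdd]
        obtain ⟨l', hl', hsort', hmem'⟩ := h.docList d'
        refine ⟨l', hl', hsort', fun y => ?_⟩
        rw [hmem' y, Finset.mem_insert]
        refine and_congr_right fun hy => and_congr_right fun _ => ?_
        have : y ≠ x := by rintro rfl; exact hdd (hy.symm.trans hd)
        simp [this]

end Market

/-! ### Correctness of a single iteration -/

namespace Market

open RealRAM

variable {nD nH n : ℕ} {M : Market (Fin nD) (Fin nH) (Fin n)} {P : M.Profile}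

/-- The potential of a state: what is left of the contracts to be considered, of those to be
proposed, and of those to be closed. -/
def potential (S : GDAState (Fin nH) (Fin n)) (σ : Store) : ℕ :=
  (n - σ.nat 8 0) + (n - S.used.card) + (openSet n σ).card

theorem lt_load_insert_insert {A : Finset (Fin n)} {x z : Fin n}
    (h : 1 < M.load (insert z A) z) : 1 < M.load (insert z (insert x A)) z :=
  h.trans_le (load_le_load_of_subset (Finset.insert_subset_insert _ (Finset.subset_insert _ _)) _)

theorem Progress.of_held {S S' : GDAState (Fin nH) (Fin n)} {i d : ℕ}
    (h : M.Progress P S i d) (hheld : S.held ⊆ S'.held) (hused : S.used ⊆ S'.used) :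
    M.Progress P S' i d := by
  refine ⟨h.le, h.isDoc, fun j hj => (h.done j hj).imp_left fun hd => ?_⟩
  rcases hd with ⟨y, hy, hyd⟩ | hd
  · exact .inl ⟨y, hheld hy, hyd⟩
  · exact .inr fun x hx hxa => hused (hd x hx hxa)

theorem sub_card_insert {A : Finset (Fin n)} {x : Fin n} (hx : x ∉ A) :
    n - A.card = n - (insert x A).card + 1 := by
  have := Finset.card_le_univ (insert x A)
  rw [Finset.card_insert_of_notMem hx, Fintype.card_fin] at this
  rw [Finset.card_insert_of_notMem hx]
  omega

/-- The test for a free doctor fails, and the next doctor is considered. -/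
theorem advance_spec {S : GDAState (Fin nH) (Fin n)} {σ : Store} (h : M.Represents P S σ)
    (hp : M.Progress P S (σ.nat 8 0) (σ.nat 8 1)) (hi : σ.nat 8 0 < n)
    (hb : ¬ freeTest.holds σ) :
    M.Represents P S (advanceProg.result σ) ∧
    M.Progress P S ((advanceProg.result σ).nat 8 0) ((advanceProg.result σ).nat 8 1) ∧
    potential S (advanceProg.result σ) + 1 = potential S σ := by
  have hinv := GDAInvariant.of_reachable h.reach
  simp only [Test.holds, NExpr.eval, not_and, not_le, Nat.le_zero, Nat.lt_one_iff] at hb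
  have hres : advanceProg.result σ = (σ.writeNat 8 0 (σ.nat 8 0 + 1)).writeNat 8 1
      (σ.nat 1 (σ.nat 8 0 + 1)) := by
    simp [advanceProg, Prog.result, NExpr.eval]
  rw [hres]
  refine ⟨⟨h.reach, ?_, ?_, ?_, ?_, ?_, ?_, ?_, ?_, ?_, ?_⟩, ⟨?_, ?_, ?_⟩, ?_⟩
  · simpa using h.num
  · simpa using h.doc
  · simpa using h.hosp
  · simpa using h.size
  · simpa using h.held
  · simpa using h.matched
  · simpa using h.docList
  · simpa using h.hospList
  · simpa using h.closed
  · simpa using h.total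
  · simp; omega
  · intro hlt
    simp at hlt ⊢
    exact ⟨⟨_, hlt⟩, (h.doc ⟨_, hlt⟩).symm⟩
  · intro j hj
    simp at hj ⊢
    obtain ⟨x, hx⟩ := hp.isDoc hi
    -- the current doctor is done
    have hdone : M.Done P S (M.doc x) := by
      by_cases hm : σ.nat 14 (M.doc x) = 0
      · right
        obtain ⟨l, hl, -, hmem⟩ := h.docList (M.doc x)
        have h9 : σ.nat 9 (M.doc x) = 0 := by rw [hx] at hm ⊢; exact hb hm
        intro y hyd hya
        by_contra hy
        have := (hmem y).2 ⟨hyd, hya, hy⟩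
        cases l with
        | nil => simp at this
        | cons z l => exact hl.2.1 (hl.1 ▸ h9)
      · exact .inl ((h.matched _).1 hm)
    rcases Nat.le_or_eq_of_le_succ hj with hj | hj
    · left
      rcases hp.done j hj with hd | ⟨-, hd⟩
      · exact hd
      · rwa [Fin.ext (hd.trans hx.symm)]
    · right
      rw [show σ.nat 8 0 + 1 = j by omega]
      exact ⟨j.2, (h.doc j).symm⟩
  · simp [potential, openSet]
    omega

/-- The store after the current doctor has taken `x` from her list. -/
abbrev takeStore (M : Market (Fin nD) (Fin nH) (Fin n)) (σ : Store) (x : Fin n) : Store :=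
  (σ.writeNat 8 2 (code x)).writeNat 9 (M.doc x) (σ.nat 10 (code x))

/-- The store after the hospital of `x` has added `x` to the contracts that it holds. -/
abbrev holdStore (M : Market (Fin nD) (Fin nH) (Fin n)) (σ : Store) (x : Fin n) : Store :=
  ((((takeStore M σ x).writeNat 8 3 (M.hosp x)).writeNat 5 x 1).writeNat 14
    (M.doc x) 1).writeReal 1 (M.hosp x) (σ.real 1 (M.hosp x) + M.size x)

/-- A proposal of a closed contract changes nothing for the hospital. -/
theorem reject_spec {S S' : GDAState (Fin nH) (Fin n)} {σ : Store} (h : M.Represents P S σ)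
    (hp : M.Progress P S (σ.nat 8 0) (σ.nat 8 1)) {x : Fin n} (hx : x ∉ S.used)
    (hstep : M.GDAStep (fun _ => M.sizeGreedy) P S S') (hused : S'.used = insert x S.used)
    (hheld : S'.held = M.choose (insert x S.used))
    (hdoc : ∀ d' : Fin nD, ∃ l : List (Fin n),
        Chain (σ.nat 10) (if d' = M.doc x then σ.nat 10 (code x) else σ.nat 9 d') (l.map code) ∧
        l.Pairwise (M.Prefers P) ∧
        ∀ y, y ∈ l ↔ M.doc y = d' ∧ M.Acceptable P y ∧ y ∉ insert x S.used)
    (hclosed : σ.nat 13 (code x) ≠ 0) :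
    M.Represents P S' (takeStore M σ x) ∧
    M.Progress P S' ((takeStore M σ x).nat 8 0) ((takeStore M σ x).nat 8 1) ∧
    potential S' (takeStore M σ x) + 1 = potential S σ := by
  have hinv := GDAInvariant.of_reachable h.reach
  have hheld' : S'.held = S.held := by
    rw [hheld, choose_insert_of_lt hx (h.closed x hclosed), hinv.held_eq]
  refine ⟨⟨h.reach.tail hstep, ?_, ?_, ?_, ?_, ?_, ?_, ?_, ?_, ?_, ?_⟩, ?_, ?_⟩
  · simpa using h.num
  · simpa using h.doc
  · simpa using h.hosp
  · simpa using h.size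
  · simpa [hheld'] using h.held
  · simpa [hheld'] using h.matched
  · simpa [hused, Fin.ext_iff] using hdoc
  · simpa using h.hospList
  · intro y hy
    rw [hused]
    exact lt_load_insert_insert (h.closed y (by simpa using hy))
  · simpa [hheld'] using h.total
  · simpa using hp.of_held hheld'.ge (hused ▸ Finset.subset_insert _ _)
  · have := sub_card_insert hx
    simp [potential, openSet, hused]
    omega

/-- A proposed contract that fits is held. -/
theorem hold_spec {S S' : GDAState (Fin nH) (Fin n)} {σ : Store} (h : M.Represents P S σ)
    (hp : M.Progress P S (σ.nat 8 0) (σ.nat 8 1)) {x : Fin n} (hx : x ∉ S.used)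
    (hstep : M.GDAStep (fun _ => M.sizeGreedy) P S S') (hused : S'.used = insert x S.used)
    (hheld : S'.held = M.choose (insert x S.used))
    (hdoc : ∀ d' : Fin nD, ∃ l : List (Fin n),
        Chain (σ.nat 10) (if d' = M.doc x then σ.nat 10 (code x) else σ.nat 9 d') (l.map code) ∧
        l.Pairwise (M.Prefers P) ∧
        ∀ y, y ∈ l ↔ M.doc y = d' ∧ M.Acceptable P y ∧ y ∉ insert x S.used)
    (hfits : σ.real 1 (M.hosp x) + M.size x ≤ 1) :
    M.Represents P S' (holdStore M σ x) ∧
    M.Progress P S' ((holdStore M σ x).nat 8 0) ((holdStore M σ x).nat 8 1) ∧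
    potential S' (holdStore M σ x) + 1 = potential S σ := by
  have hinv := GDAInvariant.of_reachable h.reach
  have hxS : x ∉ S.held := fun hxh => hx (hinv.held_subset hxh)
  have hheld' : S'.held = insert x S.held := by
    rw [hheld, choose_insert_of_le hx, hinv.held_eq]
    rwa [← hinv.held_eq, ← h.total]
  refine ⟨⟨h.reach.tail hstep, ?_, ?_, ?_, ?_, ?_, ?_, ?_, ?_, ?_, ?_⟩, ?_, ?_⟩
  · simpa using h.num
  · simpa using h.doc
  · simpa using h.hosp
  · simpa using h.size
  · intro y
    have := h.held y
    rcases eq_or_ne y x with rfl | hyx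
    · simp [hheld']
    · simpa [hheld', hyx, ← Fin.ext_iff] using this
  · intro d
    have := h.matched d
    rcases eq_or_ne d (M.doc x) with rfl | hd
    · simp [hheld']
    · simpa [hheld', hd, hd.symm, ← Fin.ext_iff] using this
  · simpa [hused, Fin.ext_iff] using hdoc
  · simpa using h.hospList
  · intro y hy
    rw [hused]
    exact lt_load_insert_insert (h.closed y (by simpa using hy))
  · intro k
    rw [hheld', totalSize_insert hxS, ← h.total]
    rcases eq_or_ne k (M.hosp x) with rfl | hk
    · simp
    · simp [hk, hk.symm, ← Fin.ext_iff]
  · simpa using hp.of_held (hheld' ▸ Finset.subset_insert _ _) (hused ▸ Finset.subset_insert _ _)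
  · have := sub_card_insert hx
    simp [potential, openSet, hused]
    omega

/-- If a proposed contract does not fit, the hospital finds its largest contract by following its
list, and the doctor of that contract is the next one to propose. -/
theorem evict_spec {S S' : GDAState (Fin nH) (Fin n)} {σ : Store} (h : M.Represents P S σ)
    (hp : M.Progress P S (σ.nat 8 0) (σ.nat 8 1)) (hi : σ.nat 8 0 < n) {x : Fin n}
    (hx : x ∉ S.used) (hun : ∀ y ∈ S.held, M.doc y ≠ M.doc x) (hd : σ.nat 8 1 = M.doc x)
    (hstep : M.GDAStep (fun _ => M.sizeGreedy) P S S') (hused : S'.used = insert x S.used)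
    (hheld : S'.held = M.choose (insert x S.used))
    (hdoc : ∀ d' : Fin nD, ∃ l : List (Fin n),
        Chain (σ.nat 10) (if d' = M.doc x then σ.nat 10 (code x) else σ.nat 9 d') (l.map code) ∧
        l.Pairwise (M.Prefers P) ∧
        ∀ y, y ∈ l ↔ M.doc y = d' ∧ M.Acceptable P y ∧ y ∉ insert x S.used)
    (hopen : σ.nat 13 (code x) = 0)
    (hfits : 1 < σ.real 1 (M.hosp x) + M.size x) :
    ∃ τ t, Exec shrinkProg (holdStore M σ x) τ t ∧
      M.Represents P S' τ ∧ M.Progress P S' (τ.nat 8 0) (τ.nat 8 1) ∧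
      ∃ k, 1 ≤ k ∧ potential S' τ + k = potential S σ ∧
        t ≤ (popTest.cost + popBody.bound + evictProg.bound + 5) * k := by
  have hinv := GDAInvariant.of_reachable h.reach
  have hinv' := GDAInvariant.of_reachable (h.reach.tail hstep)
  have hxS : x ∉ S.held := fun hxh => hx (hinv.held_subset hxh)
  set ω := holdStore M σ x with hω
  set ω' := ω.writeNat 8 4 (σ.nat 11 (M.hosp x)) with hω'
  obtain ⟨l, hl, hsort, hmem⟩ := h.hospList (M.hosp x)
  have hω5 : ∀ y : Fin n, ω'.nat 5 y ≠ 0 ↔ y ∈ insert x S.held := by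
    intro y
    have := h.held y
    rcases eq_or_ne y x with rfl | hyx
    · simp [ω', ω]
    · simpa [ω', ω, hyx, ← Fin.ext_iff] using this
  obtain ⟨l₁, m, l₂, τ, t, rfl, hl₁, hm, he, ht, hA, hm4, h8, h13⟩ := exec_pop l ω'
    (by simpa [ω', ω] using hl) ⟨x, (hmem x).2 ⟨rfl, hopen⟩, by
      rw [hω5]
      exact Finset.mem_insert_self _ _⟩
  rw [hω5] at hm
  have hl₁' : ∀ y ∈ l₁, y ∉ insert x S.held := fun y hy => by
    rw [← hω5, not_not]
    exact hl₁ y hy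
  have hmh : M.hosp m = M.hosp x := ((hmem m).1 (by simp)).1
  rw [List.pairwise_append, List.pairwise_cons] at hsort
  -- what is held is not closed, so that it comes after `m` in the list
  have hmax : ∀ z ∈ insert x S.held, M.hosp z = M.hosp x → M.SizeLE z m := by
    intro z hz hzx
    have hz13 : σ.nat 13 (code z) = 0 := by
      rcases Finset.mem_insert.1 hz with rfl | hz
      · exact hopen
      · by_contra hz13
        have := h.closed z hz13
        rw [Finset.insert_eq_of_mem (hinv.held_subset hz)] at this
        rw [hinv.held_eq] at hz
        exact absurd (mem_choose.1 hz).2 (not_le.2 this)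
    have hzl := (hmem z).2 ⟨hzx, hz13⟩
    rw [List.mem_append, List.mem_cons] at hzl
    rcases hzl with hzl | rfl | hzl
    · exact absurd hz (hl₁' z hzl)
    · exact SizeLE.refl M _
    · exact (hsort.2.1.1 z hzl).1
  have hheld' : S'.held = (insert x S.held).erase m := by
    rw [hheld, choose_insert_of_exceeds hx (y := m), hinv.held_eq]
    · rwa [← hinv.held_eq, ← h.total]
    · rwa [← hinv.held_eq]
    · exact hmh
    · rwa [← hinv.held_eq]
  have hmS' : m ∉ S'.held := by rw [hheld']; exact Finset.notMem_erase _ _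
  have hmused : m ∈ S'.used := by
    rw [hused]
    exact Finset.insert_subset_insert x hinv.held_subset hm
  have hload : 1 < M.load S'.used m := by
    by_contra hle
    rw [hinv'.held_eq] at hmS'
    exact hmS' (mem_choose.2 ⟨hmused, not_lt.1 hle⟩)
  -- at most one contract of each doctor is held before the eviction
  have hinj : ∀ y ∈ insert x S.held, M.doc y = M.doc m → y = m := by
    intro y hy hym
    rcases Finset.mem_insert.1 hm with rfl | hm'
    · rcases Finset.mem_insert.1 hy with rfl | hy'
      · rfl
      · exact absurd hym (hun y hy')
    · rcases Finset.mem_insert.1 hy with rfl | hy'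
      · exact absurd hym.symm (hun m hm')
      · exact hinv.eq_of_doc_eq hy' hm' hym
  have hτ83 : τ.nat 8 3 = M.hosp x := by
    rw [h8 3 (by simp)]
    simp [ω', ω]
  have hτ1 : ∀ y : Fin n, τ.nat 1 y = M.doc y := by
    intro y
    rw [hA.2 1 (by simp)]
    simpa [ω', ω] using h.doc y
  have hτsize : ∀ y : Fin n, τ.real 0 y = M.size y := by
    intro y
    rw [hA.1]
    simpa [ω', ω] using h.size y
  have hτ12 : τ.nat 12 = σ.nat 12 := by
    rw [hA.2 12 (by simp)]
    simp [ω', ω]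
  have hfree : evictProg.LoopFree := by simp [evictProg, Prog.LoopFree]
  obtain ⟨t', he', ht'⟩ := hfree.exec τ
  have hres : evictProg.result τ = (((((τ.writeNat 13 (code m) 1).writeNat 11 (M.hosp x)
      (σ.nat 12 (code m))).writeNat 5 m 0).writeReal 1 (M.hosp x)
      (τ.real 1 (M.hosp x) - M.size m)).writeNat 8 1 (M.doc m)).writeNat 14 (M.doc m) 0 := by
    simp [evictProg, Prog.result, NExpr.eval, RExpr.eval, hm4, hτ83, hτ1, hτsize, hτ12]
  set υ := evictProg.result τ with hυ
  have hυ13 : ∀ y : Fin n, υ.nat 13 (code y) = 0 ↔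
      σ.nat 13 (code y) = 0 ∧ y ∉ l₁ ∧ y ≠ m := by
    intro y
    have := h13 y
    rw [show ω'.nat 13 (code y) = σ.nat 13 (code y) by simp [ω', ω]] at this
    rcases eq_or_ne y m with rfl | hym
    · simp [hres]
    · simpa [hres, hym] using this
  have hreal : ∀ k : Fin nH, τ.real 1 k = M.totalSize (insert x S.held) k := by
    intro k
    rw [hA.1, totalSize_insert hxS, ← h.total]
    rcases eq_or_ne k (M.hosp x) with rfl | hk
    · simp [ω', ω]
    · simp [ω', ω, hk, hk.symm, ← Fin.ext_iff]
  have hexec : Exec shrinkProg ω υ (1 + (NExpr.get 11 (var 3)).cost + 1 + (t + t')) := by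
    have h1 := Exec.setNat ω 8 (.const 4) (.get 11 (var 3))
    have h2 : ω.writeNat 8 ((NExpr.const 4).eval ω) ((NExpr.get 11 (var 3)).eval ω) = ω' := by
      simp [NExpr.eval, ω', ω]
    rw [h2] at h1
    exact .seq h1 (.seq he he')
  refine ⟨υ, _, hexec, ⟨h.reach.tail hstep, ?_, ?_, ?_, ?_, ?_, ?_, ?_, ?_, ?_, ?_⟩, ⟨?_, ?_, ?_⟩,
    1 + (l₁.length + 1), by omega, ?_, ?_⟩
  · rw [hres]
    simpa [hA.2 0, ω', ω] using h.num
  · simpa [hres] using hτ1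
  · simpa [hres, hA.2 2, ω', ω] using h.hosp
  · simpa [hres] using hτsize
  · intro y
    have := hω5 y
    rcases eq_or_ne y m with rfl | hym
    · simp [hres, hheld']
    · rw [hheld', Finset.mem_erase, ← this]
      simp [hres, hA.2 5, hym, ← Fin.ext_iff]
  · intro d
    rw [hheld']
    rcases eq_or_ne d (M.doc m) with rfl | hdm
    · simp only [hres, nat_writeNat, and_self, if_true, ne_eq, not_true, false_iff]
      rintro ⟨y, hy, hym⟩
      exact (Finset.mem_erase.1 hy).1 (hinj y (Finset.mem_erase.1 hy).2 hym)
    · have h14 : υ.nat 14 d = if d = M.doc x then 1 else σ.nat 14 d := by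
        simp [hres, hdm, ← Fin.ext_iff, hA.2 14, ω', ω]
      rw [h14]
      split_ifs with hdx
      · subst hdx
        simp only [ne_eq, one_ne_zero, not_false_iff, true_iff]
        refine ⟨x, Finset.mem_erase.2 ⟨?_, Finset.mem_insert_self _ _⟩, rfl⟩
        rintro rfl
        exact hdm rfl
      · rw [h.matched]
        constructor
        · rintro ⟨y, hy, rfl⟩
          refine ⟨y, Finset.mem_erase.2 ⟨?_, Finset.mem_insert_of_mem hy⟩, rfl⟩
          rintro rfl
          exact hdm rfl
        · rintro ⟨y, hy, rfl⟩
          rcases Finset.mem_insert.1 (Finset.mem_erase.1 hy).2 with rfl | hy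
          · exact absurd rfl hdx
          · exact ⟨y, hy, rfl⟩
  · simpa [hres, hA.2 10, hA.2 9, ω', ω, hused, Fin.ext_iff] using hdoc
  · intro k
    have hυ12 : υ.nat 12 = σ.nat 12 := by simp [hres, hτ12]
    rw [hυ12]
    rcases eq_or_ne k (M.hosp x) with rfl | hk
    · refine ⟨l₂, ?_, hsort.2.1.2, fun y => ?_⟩
      · rw [List.map_append, List.map_cons] at hl
        simpa [hres] using hl.drop
      · have hy := hmem y
        rw [List.mem_append, List.mem_cons] at hy
        rw [hυ13, ← and_assoc, ← hy]
        constructor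
        · intro hyl
          refine ⟨.inr (.inr hyl), fun hyl₁ => ?_, fun hym => ?_⟩
          · exact (hsort.2.2 y hyl₁ y (List.mem_cons_of_mem _ hyl)).2 rfl
          · exact (hsort.2.1.1 y hyl).2 hym.symm
        · rintro ⟨h1 | h1 | h1, h2, h3⟩
          · exact absurd h1 h2
          · exact absurd h1 h3
          · exact h1
    · obtain ⟨l, hl, hsort', hmem'⟩ := h.hospList k
      refine ⟨l, ?_, hsort', fun y => ?_⟩
      · simpa [hres, hk, ← Fin.ext_iff, hA.2 11, ω', ω] using hl
      · rw [hmem', hυ13]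
        refine and_congr_right fun hyk => ?_
        have h1 : y ∉ l₁ := fun hy => hk (hyk.symm.trans ((hmem y).1 (by simp [hy])).1)
        have h2 : y ≠ m := by
          rintro rfl
          exact hk (hyk.symm.trans hmh)
        simp [h1, h2]
  · intro y hy
    rw [ne_eq, hυ13] at hy
    by_cases hy' : σ.nat 13 (code y) = 0
    · have hym : M.hosp m = M.hosp y ∧ M.SizeLE m y := by
        by_cases hyl : y ∈ l₁
        · exact ⟨hmh.trans ((hmem y).1 (by simp [hyl])).1.symm,
            (hsort.2.2 y hyl m (by simp)).1⟩
        · have : y = m := by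
            by_contra hne
            exact hy ⟨hy', hyl, hne⟩
          exact this ▸ ⟨rfl, SizeLE.refl M _⟩
      exact hload.trans_le ((load_le_load_of_sizeLE hym.1 hym.2).trans
        (load_le_load_of_subset (Finset.subset_insert _ _) _))
    · rw [hused]
      exact lt_load_insert_insert (h.closed y hy')
  · intro k
    rw [hheld', totalSize_erase hm, hmh, ← hreal k]
    rcases eq_or_ne k (M.hosp x) with rfl | hk
    · simp [hres]
    · simp [hres, hk, hk.symm, ← Fin.ext_iff]
  · simpa [hres, h8, ω', ω] using hp.le
  · intro _
    exact ⟨m, by simp [hres]⟩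
  · have h80 : υ.nat 8 0 = σ.nat 8 0 := by simp [hres, h8, ω', ω]
    rw [h80]
    intro j hj
    rcases eq_or_ne (M.doc j) (M.doc m) with hjm | hjm
    · exact .inr ⟨hi, by rw [hjm]; simp [hres]⟩
    · left
      have hkeep : ∀ y ∈ insert x S.held, M.doc y = M.doc j → M.Done P S' (M.doc j) := by
        intro y hy hyj
        refine .inl ⟨y, ?_, hyj⟩
        rw [hheld']
        refine Finset.mem_erase.2 ⟨?_, hy⟩
        rintro rfl
        exact hjm hyj.symm
      rcases hp.done j hj with (⟨y, hy, hyj⟩ | hall) | ⟨-, hjx⟩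
      · exact hkeep y (Finset.mem_insert_of_mem hy) hyj
      · refine .inr fun z hz hza => ?_
        rw [hused]
        exact Finset.mem_insert_of_mem (hall z hz hza)
      · exact hkeep x (Finset.mem_insert_self _ _) (Fin.ext (hd.symm.trans hjx.symm))
  · have h80 : υ.nat 8 0 = σ.nat 8 0 := by simp [hres, h8, ω', ω]
    have hcard : (openSet n υ).card + (l₁.length + 1) = (openSet n σ).card := by
      have hnodup : (m :: l₁).Nodup := by
        refine List.nodup_cons.2 ⟨fun hml => (hsort.2.2 m hml m (by simp)).2 rfl, ?_⟩
        exact hsort.1.imp fun hab => hab.2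
      have hlen : (m :: l₁).toFinset.card = l₁.length + 1 := by
        rw [List.toFinset_card_of_nodup hnodup, List.length_cons]
      rw [← hlen, ← Finset.card_union_of_disjoint]
      · congr 1
        ext y
        simp only [openSet, Finset.mem_union, Finset.mem_filter, Finset.mem_univ, true_and, hυ13,
          List.mem_toFinset, List.mem_cons]
        constructor
        · rintro (hy | rfl | hy)
          · exact hy.1
          · exact ((hmem y).1 (by simp)).2
          · exact ((hmem y).1 (by simp [hy])).2
        · intro hy
          by_cases h1 : y = m
          · exact .inr (.inl h1)
          · by_cases h2 : y ∈ l₁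
            · exact .inr (.inr h2)
            · exact .inl ⟨hy, h2, h1⟩
      · rw [Finset.disjoint_left]
        intro y hy hy'
        simp only [openSet, Finset.mem_filter, Finset.mem_univ, true_and, hυ13] at hy
        simp only [List.mem_toFinset, List.mem_cons] at hy'
        rcases hy' with hy' | hy'
        · exact hy.2.2 hy'
        · exact hy.2.1 hy'
    have := sub_card_insert hx
    simp only [potential, h80, hused]
    omega
  · have h1 : popTest.cost ≤ popTest.cost + popBody.bound := Nat.le_add_right _ _
    simp only [NExpr.cost]
    generalize popTest.cost + popBody.bound = c at *
    have : (c + evictProg.bound + 5) * (1 + (l₁.length + 1)) =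
      c * l₁.length + c * 2 + evictProg.bound * 2 + 10 +
        (evictProg.bound * l₁.length + 5 * l₁.length) := by ring
    omega

end Market

/-! ### Running time of deferred acceptance -/

namespace Market

open RealRAM

variable {nD nH n : ℕ} {M : Market (Fin nD) (Fin nH) (Fin n)} {P : M.Profile}

/-- The potential pays for each iteration, including the search in the list of a hospital. -/
theorem proposeBody_spec : ∃ c : ℕ, ∀ (nD nH n : ℕ) (M : Market (Fin nD) (Fin nH) (Fin n))
    (P : M.Profile) (S : GDAState (Fin nH) (Fin n)) (σ : Store), M.Represents P S σ →
    M.Progress P S (σ.nat 8 0) (σ.nat 8 1) → σ.nat 8 0 < n →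
    ∃ τ t S' k, Exec proposeBody σ τ t ∧ M.Represents P S' τ ∧
      M.Progress P S' (τ.nat 8 0) (τ.nat 8 1) ∧ potential S' τ + k = potential S σ ∧
      moreTest.cost + t ≤ c * k := by
  set e := popTest.cost + popBody.bound + evictProg.bound + 5 with he
  set b := moreTest.cost + freeTest.cost + takeProg.bound + openTest.cost + holdProg.bound +
    fitsTest.cost + 1 + advanceProg.bound with hb
  refine ⟨b + e, fun nD nH n M P S σ h hp hi => ?_⟩
  by_cases hfree : freeTest.holds σ
  swap
  · obtain ⟨t, hex, ht⟩ := (show advanceProg.LoopFree by simp [advanceProg, Prog.LoopFree]).exec σ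
    obtain ⟨h1, h2, h3⟩ := advance_spec h hp hi hfree
    exact ⟨_, _, S, 1, .condFalse hfree hex, h1, h2, h3, by omega⟩
  obtain ⟨z, hz⟩ := hp.isDoc hi
  have hfree' := hfree
  simp only [Test.holds, NExpr.eval, Nat.le_zero, ← hz] at hfree'
  obtain ⟨x, hx9, hxd, hx, hun, ⟨S', hstep, hused, hheld⟩, hdoc⟩ :=
    h.take hfree'.1 (Nat.one_le_iff_ne_zero.1 hfree'.2)
  rw [← hxd] at hz hx9 hun hdoc
  obtain ⟨t₁, hex₁, ht₁⟩ := (show takeProg.LoopFree by simp [takeProg, Prog.LoopFree]).exec σ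
  have htake : takeProg.result σ = takeStore M σ x := by
    simp [takeProg, Prog.result, NExpr.eval, ← hz, hx9]
  rw [htake] at hex₁
  by_cases hopen : openTest.holds (takeStore M σ x)
  swap
  · have h13 : σ.nat 13 (code x) ≠ 0 := by
      simpa [Test.holds, NExpr.eval] using hopen
    obtain ⟨h1, h2, h3⟩ := reject_spec h hp hx hstep hused hheld hdoc h13
    refine ⟨_, _, S', 1, .condTrue hfree (.seq hex₁ (.condFalse hopen (.skip _))), h1, h2, h3, ?_⟩
    omega
  have h13 : σ.nat 13 (code x) = 0 := by
    simpa [Test.holds, NExpr.eval] using hopen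
  obtain ⟨t₂, hex₂, ht₂⟩ := (show holdProg.LoopFree by simp [holdProg, Prog.LoopFree]).exec
    (takeStore M σ x)
  have hhold : holdProg.result (takeStore M σ x) = holdStore M σ x := by
    simp [holdProg, Prog.result, NExpr.eval, RExpr.eval, ← hz, h.hosp, h.size]
  rw [hhold] at hex₂
  have hfit : fitsTest.holds (holdStore M σ x) ↔ σ.real 1 (M.hosp x) + M.size x ≤ 1 := by
    simp [Test.holds, RExpr.eval, NExpr.eval]
  by_cases hfits : fitsTest.holds (holdStore M σ x)
  · obtain ⟨h1, h2, h3⟩ := hold_spec h hp hx hstep hused hheld hdoc (hfit.1 hfits)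
    refine ⟨_, _, S', 1, .condTrue hfree (.seq hex₁ (.condTrue hopen (.seq hex₂
      (.condTrue hfits (.skip _))))), h1, h2, h3, ?_⟩
    omega
  · obtain ⟨τ, t₃, hex₃, h1, h2, k, hk, h3, ht₃⟩ := evict_spec h hp hi hx hun hz.symm hstep hused
      hheld hdoc h13 (not_le.1 fun h => hfits (hfit.2 h))
    refine ⟨_, _, S', k, .condTrue hfree (.seq hex₁ (.condTrue hopen (.seq hex₂
      (.condFalse hfits hex₃)))), h1, h2, h3, ?_⟩
    rw [← he] at ht₃
    rw [add_mul]
    have : b ≤ b * k := Nat.le_mul_of_pos_right _ hk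
    omega

/-- If the linked lists have been set up, then deferred acceptance runs in linear time. -/
theorem exec_acceptance : ∃ c : ℕ, ∀ (nD nH n : ℕ) (M : Market (Fin nD) (Fin nH) (Fin n))
    (P : M.Profile) (σ : Store), M.Represents P gdaInit σ →
    ∃ τ t, Exec acceptanceProg σ τ t ∧ t ≤ c * (n + 1) ∧
      M.IsGDAOutput (fun _ => M.sizeGreedy) P (outputSet n τ) := by
  obtain ⟨c, hc⟩ := proposeBody_spec
  refine ⟨3 * c + moreTest.cost + 10, fun nD nH n M P σ h => ?_⟩
  have hR : M.Represents P gdaInit ((σ.writeNat 8 0 0).writeNat 8 1 (σ.nat 1 0)) := by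
    refine ⟨h.reach, ?_, ?_, ?_, ?_, ?_, ?_, ?_, ?_, ?_, ?_⟩
    · simpa using h.num
    · simpa using h.doc
    · simpa using h.hosp
    · simpa using h.size
    · simpa using h.held
    · simpa using h.matched
    · simpa using h.docList
    · simpa using h.hospList
    · simpa using h.closed
    · simpa using h.total
  have hP : M.Progress P gdaInit 0 (σ.nat 1 0) := by
    refine ⟨Nat.zero_le _, fun h0 => ⟨⟨0, h0⟩, (h.doc ⟨0, h0⟩).symm⟩, fun j hj => .inr ?_⟩
    have hj0 : (j : ℕ) = 0 := Nat.le_zero.1 hj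
    exact ⟨hj0 ▸ j.2, by rw [← h.doc j, hj0]⟩
  obtain ⟨τ, t, k', hex, ht, ⟨S, hS, hprog, -⟩, hb⟩ := exec_loop_of_credit (b := moreTest)
    (p := proposeBody)
    (fun υ k => ∃ S, M.Represents P S υ ∧ M.Progress P S (υ.nat 8 0) (υ.nat 8 1) ∧
      k = c * potential S υ)
    (fun υ k ⟨S, hS, hprog, hk⟩ hb => by
      simp only [Test.holds, NExpr.eval, hS.num, not_le] at hb
      obtain ⟨τ, t, S', k', h1, h2, h3, h4, h5⟩ := hc nD nH n M P S υ hS hprog hb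
      refine ⟨τ, t, _, h1, ⟨S', h2, h3, rfl⟩, ?_⟩
      rw [hk, ← h4, mul_add]
      omega)
    (σ := (σ.writeNat 8 0 0).writeNat 8 1 (σ.nat 1 0))
    ⟨gdaInit, hR, by simpa using hP, rfl⟩
  simp only [Test.holds, NExpr.eval, hS.num, not_not] at hb
  have hstart : ((setVar 0 (.const 0)).seq (setVar 1 (.get 1 (.const 0)))).result σ
      = (σ.writeNat 8 0 0).writeNat 8 1 (σ.nat 1 0) := by
    simp [Prog.result, NExpr.eval]
  obtain ⟨t₀, hex₀, ht₀⟩ := (show ((setVar 0 (.const 0)).seq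
    (setVar 1 (.get 1 (.const 0)))).LoopFree by simp [Prog.LoopFree]).exec σ
  rw [hstart] at hex₀
  refine ⟨τ, _, .seq hex₀ hex, ?_, S, hS.reach, ?_, ?_⟩
  · have hpot : potential (nH := nH) (n := n) gdaInit
        ((σ.writeNat 8 0 0).writeNat 8 1 (σ.nat 1 0)) ≤ 3 * n := by
      have := Finset.card_le_univ (openSet n ((σ.writeNat 8 0 0).writeNat 8 1 (σ.nat 1 0)))
      rw [Fintype.card_fin] at this
      simp only [potential]
      omega
    have h1 := Nat.mul_le_mul_left c hpot
    have h2 : ((setVar 0 (.const 0)).seq (setVar 1 (.get 1 (.const 0)))).bound ≤ 10 := by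
      simp [Prog.bound, NExpr.cost]
    have h3 : (3 * c + moreTest.cost + 10) * (n + 1) =
      c * (3 * n) + 3 * c + moreTest.cost + 10 + (moreTest.cost * n + 10 * n) := by ring
    omega
  · rw [exists_step_iff]
    rintro ⟨x, hacc, hx, hun⟩
    rcases hprog.done x (x.2.le.trans hb) with (⟨y, hy, hyx⟩ | hall) | ⟨hlt, -⟩
    · exact hun y hy hyx
    · exact hx (hall x rfl hacc)
    · omega
  · ext x
    simp [outputSet, hS.held x]

/-! ### Setting up the lists -/

/-- The test whether the contract in variable `2` is at most as good for its doctor as the one in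
variable `3`. -/
def rankTest : Test :=
  .nle (.get 3 (.sub (var 3) (.const 1))) (.get 3 (.sub (var 2) (.const 1)))

/-- The test whether the contract in variable `4` is acceptable. -/
def acceptableTest : Test :=
  .neg (.nle (.get 4 (.get 1 (.sub (var 4) (.const 1)))) (.get 3 (.sub (var 4) (.const 1))))

/-- The test whether the contract in variable `2` is at most as large as the one in variable `3`,
where ties are resolved by index. -/
def sizeTest : Test :=
  .conj (.rle (.get 0 (.sub (var 2) (.const 1))) (.get 0 (.sub (var 3) (.const 1))))
    (.neg (.conj (.rle (.get 0 (.sub (var 3) (.const 1))) (.get 0 (.sub (var 2) (.const 1))))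
      (.neg (.nle (var 2) (var 3)))))

/-- Generalized deferred acceptance: sort the acceptable contracts of each doctor by her
preference, sort the contracts of each hospital by size, and run deferred acceptance. -/
def gdaProg : Prog :=
  .seq (listsProg rankTest acceptableTest 1 9 10) <|
  .seq (listsProg sizeTest (.nle (.const 0) (.const 0)) 2 11 12) acceptanceProg

variable {rank : ∀ d, Option {x : Fin n // M.doc x = d} → ℕ}

theorem inputStore_rank (x : Fin n) {d : Fin nD} (hd : M.doc x = d) :
    (M.inputStore rank).nat 3 x = rank d (some ⟨x, hd⟩) := by
  subst hd
  simp [inputStore]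

theorem prefers_iff_rank (hr : M.Ranks P rank) {x y : Fin n} (hd : M.doc x = M.doc y) :
    M.Prefers P x y ↔ (M.inputStore rank).nat 3 x < (M.inputStore rank).nat 3 y := by
  rw [← rel_some_iff rfl hd.symm, hr, inputStore_rank x rfl, inputStore_rank y hd.symm]

theorem acceptable_iff_rank (hr : M.Ranks P rank) (x : Fin n) :
    M.Acceptable P x ↔
      (M.inputStore rank).nat 3 x < (M.inputStore rank).nat 4 (M.doc x) := by
  rw [Acceptable, hr, inputStore_rank x rfl]
  simp [inputStore]

/-- Lists of numbers are lists of contracts. -/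
theorem exists_list_of_chain {nx : ℕ → ℕ} {c : ℕ} {r : ℕ → ℕ → Prop} {p : ℕ → Prop}
    (h : ∃ l, Chain nx c l ∧ l.Pairwise r ∧ l.Nodup ∧ ∀ c, c ∈ l ↔ c ∈ Finset.Icc 1 n ∧ p c) :
    ∃ l : List (Fin n), Chain nx c (l.map code) ∧
      l.Pairwise (fun a b => r (code a) (code b) ∧ a ≠ b) ∧ ∀ x, x ∈ l ↔ p (code x) := by
  obtain ⟨l, hl, hr, hn, hmem⟩ := h
  obtain ⟨l, rfl⟩ := exists_map_code fun c hc => ((hmem c).1 hc).1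
  refine ⟨l, hl, (List.pairwise_map.1 hr).and (List.Nodup.of_map _ hn), fun x => ?_⟩
  have := hmem (code x)
  rw [List.mem_map_of_injective code_injective] at this
  rw [this, and_iff_right]
  simp only [Finset.mem_Icc, code]
  omega

theorem exec_gdaProg : ∃ K : ℕ, ∀ (nD nH n : ℕ) (M : Market (Fin nD) (Fin nH) (Fin n))
    (P : M.Profile) (rank : ∀ d, Option {x : Fin n // M.doc x = d} → ℕ), M.Ranks P rank →
    ∃ τ t, Exec gdaProg (M.inputStore rank) τ t ∧
      t ≤ K * (n * (Nat.log 2 (2 * n) + 1) + 1) ∧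
      M.IsGDAOutput (fun _ => M.sizeGreedy) P (outputSet n τ) := by
  obtain ⟨K₁, hK₁⟩ := exec_lists (g := 1) (hd := 9) (nx := 10) rankTest acceptableTest
    (by simp) (by simp) (by simp) (by simp)
  obtain ⟨K₂, hK₂⟩ := exec_lists (g := 2) (hd := 11) (nx := 12) sizeTest
    (.nle (.const 0) (.const 0)) (by simp) (by simp) (by simp) (by simp)
  obtain ⟨K₃, hK₃⟩ := exec_acceptance
  refine ⟨K₁ + K₂ + K₃, fun nD nH n M P rank hr => ?_⟩
  set σ₀ := M.inputStore rank with hσ₀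
  obtain ⟨σ₁, t₁, hex₁, ht₁, hA₁, hl₁⟩ := hK₁
    (fun a b => σ₀.nat 3 (b - 1) ≤ σ₀.nat 3 (a - 1))
    (fun c => σ₀.nat 3 (c - 1) < σ₀.nat 4 (σ₀.nat 1 (c - 1))) σ₀ n
    (fun a b => le_total _ _) (fun a b c h h' => h'.trans h) (by simp [σ₀, inputStore])
    (by simp [σ₀, inputStore])
    (fun σ hσ => by
      simp [rankTest, Test.holds, NExpr.eval, hσ.2 3 (by simp [scratch])])
    (fun σ hσ => by
      simp [acceptableTest, Test.holds, NExpr.eval, hσ.2 3 (by simp [scratch]),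
        hσ.2 4 (by simp [scratch]), hσ.2 1 (by simp [scratch])])
  obtain ⟨σ₂, t₂, hex₂, ht₂, hA₂, hl₂⟩ := hK₂
    (fun a b => σ₀.real 0 (a - 1) ≤ σ₀.real 0 (b - 1) ∧
      ¬ (σ₀.real 0 (b - 1) ≤ σ₀.real 0 (a - 1) ∧ ¬ a ≤ b))
    (fun _ => True) σ₁ n
    (fun a b => by
      rcases le_total (σ₀.real 0 (a - 1)) (σ₀.real 0 (b - 1)) with h | h <;>
        rcases le_total a b with h' | h' <;> grind)
    (fun a b c h h' => by grind) (by
      rw [hA₁.2 0 (by simp [scratch])]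
      simp [σ₀, inputStore])
    (by
      intro v
      rw [hA₁.2 11 (by simp [scratch])]
      simp [σ₀, inputStore])
    (fun σ hσ => by
      simp [sizeTest, Test.holds, RExpr.eval, NExpr.eval, hσ.1, hA₁.1])
    (fun σ hσ => by simp [Test.holds, NExpr.eval])
  have hnat : ∀ a, a ≤ 5 ∨ 13 ≤ a → σ₂.nat a = σ₀.nat a := by
    intro a ha
    rw [hA₂.2 a (by simp only [scratch, Set.mem_ofPred_eq]; omega),
      hA₁.2 a (by simp only [scratch, Set.mem_ofPred_eq]; omega)]
  have hreal : σ₂.real = σ₀.real := hA₂.1.trans hA₁.1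
  have hR : M.Represents P gdaInit σ₂ := by
    refine ⟨.refl, ?_, ?_, ?_, ?_, ?_, ?_, fun d => ?_, fun h => ?_, ?_, ?_⟩
    · rw [hnat 0 (by simp)]
      simp [σ₀, inputStore]
    · rw [hnat 1 (by simp)]
      simp [σ₀, inputStore]
    · rw [hnat 2 (by simp)]
      simp [σ₀, inputStore]
    · rw [hreal]
      simp [σ₀, inputStore]
    · rw [hnat 5 (by simp)]
      simp [σ₀, inputStore, gdaInit]
    · rw [hnat 14 (by simp)]
      simp [σ₀, inputStore, gdaInit]
    · rw [hA₂.2 10 (by simp [scratch]), hA₂.2 9 (by simp [scratch])]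
      obtain ⟨l, hl, hsort, hmem⟩ := exists_list_of_chain (hl₁ d)
      have hmem' : ∀ x, x ∈ l ↔ M.doc x = d ∧ M.Acceptable P x := by
        intro x
        have h1 : σ₀.nat 1 x = M.doc x := by simp [σ₀, inputStore]
        rw [hmem, acceptable_iff_rank hr, code_sub_one, h1, Fin.val_inj, and_comm]
      refine ⟨l, hl, hsort.imp_of_mem fun {a b} ha hb hab => ?_, fun x => ?_⟩
      · have hdoc := ((hmem' a).1 ha).1.trans ((hmem' b).1 hb).1.symm
        refine (Prefers.total hdoc hab.2).resolve_right fun h => ?_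
        rw [prefers_iff_rank hr hdoc.symm] at h
        exact absurd hab.1 (not_le.2 h)
      · simp [hmem', gdaInit]
    · obtain ⟨l, hl, hsort, hmem⟩ := exists_list_of_chain (hl₂ h)
      refine ⟨l, hl, hsort.imp fun {a b} hab => ?_, fun x => ?_⟩
      · refine ⟨?_, hab.2⟩
        have h1 : ∀ x : Fin n, σ₀.real 0 x = M.size x := fun x => by simp [σ₀, inputStore]
        have := hab.1
        simp only [code_sub_one, h1, not_and, not_not] at this
        rcases this.1.lt_or_eq with h | h
        · exact .inl h
        · exact .inr ⟨h, by simpa [code] using this.2 h.ge⟩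
      · rw [hmem, hnat 13 (by simp), hA₁.2 2 (by simp [scratch])]
        simp [σ₀, inputStore, Fin.ext_iff]
    · rw [hnat 13 (by simp)]
      simp [σ₀, inputStore]
    · rw [hreal]
      simp [σ₀, inputStore, gdaInit, totalSize]
  obtain ⟨σ₃, t₃, hex₃, ht₃, hout⟩ := hK₃ nD nH n M P σ₂ hR
  refine ⟨σ₃, _, .seq hex₁ (.seq hex₂ hex₃), ?_, hout⟩
  have h1 : n + 1 ≤ n * (Nat.log 2 (2 * n) + 1) + 1 :=
    Nat.succ_le_succ (Nat.le_mul_of_pos_right _ (Nat.succ_pos _))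
  have h2 := Nat.mul_le_mul_left K₃ h1
  rw [add_mul, add_mul]
  omega

theorem mul_height_add_one_le {n : ℕ} (hn : 2 ≤ n) :
    ((n * (Nat.log 2 (2 * n) + 1) + 1 : ℕ) : ℝ) ≤ 8 * (n * Real.log n) := by
  have hn' : (2 : ℝ) ≤ n := by exact_mod_cast hn
  have hlog2 : 1 / 2 < Real.log 2 := by linarith [Real.log_two_gt_d9]
  have hlog : Real.log 2 ≤ Real.log n := Real.log_le_log (by norm_num) hn'
  have h1 : (Nat.log 2 n : ℝ) ≤ 2 * Real.log n := by
    refine (Real.natLog_le_logb n 2).trans ?_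
    rw [Real.logb, Nat.cast_ofNat, div_le_iff₀ (by linarith)]
    nlinarith
  have h2 : Nat.log 2 (2 * n) = Nat.log 2 n + 1 := by
    rw [mul_comm, Nat.log_mul_base one_lt_two (by omega)]
  rw [h2]
  push_cast
  nlinarith

end Market

end

theorem theorem8 :
    (∀ (D : Type u) (H : Type v) (X : Type w) [Finite D] [Finite H] [Fintype X] [LinearOrder X]
        (M : Market D H X), M.Proportional →
      (∃ f : M.Profile → Finset X, M.IsGDAMechanism (fun _ => M.sizeGreedy) f) ∧
      ∀ f : M.Profile → Finset X, M.IsGDAMechanism (fun _ => M.sizeGreedy) f →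
        M.StrategyProof f ∧
        (∀ P : M.Profile, M.IsMatching (f P)) ∧
        (M.maxSize < 1 → ∀ P : M.Profile, M.IsStable P (1 / (1 - M.maxSize)) (f P))) ∧
    (∃ (p : RealRAM.Prog) (C : ℝ),
      ∀ (nD nH n : ℕ) (M : Market (Fin nD) (Fin nH) (Fin n)), M.Proportional →
      ∀ (P : M.Profile) (rank : ∀ d, Option {x : Fin n // M.doc x = d} → ℕ), M.Ranks P rank →
        ∃ (σ : RealRAM.Store) (t : ℕ), RealRAM.Exec p (M.inputStore rank) σ t ∧
          M.IsGDAOutput (fun _ => M.sizeGreedy) P (Market.outputSet n σ) ∧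
          (2 ≤ n → (t : ℝ) ≤ C * (n * Real.log n))) := by
  constructor
  · intro D H X _ _ _ _ M hM
    refine ⟨⟨_, fun P => (Market.exists_isGDAOutput P).choose_spec⟩, fun f hf =>
      ⟨hf.strategyProof, fun P => ?_, fun hs P => ?_⟩⟩
    · obtain ⟨σ, hσ, -, hY⟩ := hf P
      exact hY ▸ (Market.GDAInvariant.of_reachable hσ).isMatching
    · obtain ⟨σ, hσ, hfin, hY⟩ := hf P
      exact hY ▸ (Market.GDAInvariant.of_reachable hσ).isStable hfin hM hs
  · obtain ⟨K, hK⟩ := Market.exec_gdaProg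
    refine ⟨Market.gdaProg, K * 8, fun nD nH n M _ P rank hr => ?_⟩
    obtain ⟨τ, t, hex, ht, hout⟩ := hK nD nH n M P rank hr
    refine ⟨τ, t, hex, hout, fun hn => ?_⟩
    calc (t : ℝ) ≤ ((K * (n * (Nat.log 2 (2 * n) + 1) + 1) : ℕ) : ℝ) := by exact_mod_cast ht
      _ = K * ((n * (Nat.log 2 (2 * n) + 1) + 1 : ℕ) : ℝ) := Nat.cast_mul _ _
      _ ≤ K * (8 * (n * Real.log n)) :=
        mul_le_mul_of_nonneg_left (Market.mul_height_add_one_le hn) (Nat.cast_nonneg _)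
      _ = K * 8 * (n * Real.log n) := by ring
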